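/- **Setting.** Let $p,q\ge 0$ and consider a partially observed multivariate Hawkes process (PO-MHP) with $p$ observed and $q$ latent subprocesses, $l=p+q$, background intensities $\mu_i\ge 0$ and piecewise continuous, integrable excitation functions $\phi_{ij}\ge 0$ on $(0,\infty)$ ($\phi_{ij}$ is the influence of type $j$ on type $i$; cycles and self-loops are allowed), such that the matrix $\big(\int_0^\infty\phi_{ij}(s)\,ds\big)_{i,j}$ has spectral radius less than $1$. Fix a bin width $\Delta>0$ and put $\theta_{ij}^{(k)}=\int_{(k-1)\Delta}^{k\Delta}\phi_{ij}(s)\,ds$ for $k\ge 1$. The *window causal graph* is the directed acyclic graph whose nodes are the variables $N_i^{(n)}$ ($1\le i\le l$, $n\ge 1$), with an edge $N_j^{(n-k)}\to N_i^{(n)}$ (where $k\geq 1$ and $n-k\ge 1$) iff $\theta_{ij}^{(k)}\ne 0$. A *linear model* of the PO-MHP is a family of real random variables $N_i^{(n)}$ on a probability space with $N_i^{(0)}=0$ and $$N^{(n)}_{i}=\sum_{j=1}^{l}\sum_{k=1}^{n}\theta^{(k)}_{ij}N^{(n-k)}_{j}+\varepsilon^{(n)}_{i}+\Delta\mu_i\quad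 (n\ge 1)\quad\text{almost surely},$$ where the noise variables $\varepsilon_i^{(n)}$ are square integrable, centred, of positive variance, and pairwise uncorrelated (for different pairs $(i,n)$). For finite sets of variables $R,S$ let $\Sigma_{R,S}$ be their cross-covariance matrix. A linear model is *rank faithful* if every rank constraint $\operatorname{rank}\Sigma_{R,S}\le r$ that holds in it holds in every linear model of every PO-MHP having the same $p,q$, $\Delta$ and window causal graph. **Lemma (D-separation and Rank Constraints in the Window Graph).** Let $\mathbf A_v,\mathbf B_v,\mathbf C_v$ be pairwise disjoint finite sets of variables of the window causal graph of a PO-MHP. 1. If $\mathbf C_v$ d-separates $\mathbf A_v$ and $\mathbf B_v$ in the window causal graph, then $\operatorname{rank}(\Sigma_{\mathbf A_v\cup\mathbf C_v,\ \mathbf B_v\cup\mathbf C_v})=|\mathbf C_v|$ in every linear model of the PO-MHP. 2. In every rank-faithful linear model of the PO-MHP, $\mathbf C_v$ d-separates $\mathbf A_v$ and $\mathbf B_v$ if and only if $\operatorname{rank}(\Sigma_{\mathbf A_v\cup\mathbf C_v,\ \mathbf B_v\cup\mathbf C_v})=|\mathbf C_v|$. 3. Without any faithfulness assumption, $\mathbf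 C_v$ d-separates $\mathbf A_v$ and $\mathbf B_v$ if and only if $\operatorname{rank}(\Sigma_{\mathbf A_v\cup\mathbf C_v,\ \mathbf B_v\cup\mathbf C_v})=|\mathbf C_v|$ holds in every linear model of every PO-MHP having the same $p,q$, $\Delta$ and window causal graph. -/

import Mathlib

namespace POMHP

/-- `f` is piecewise continuous on `(0, ∞)`: finitely many discontinuities on every bounded
interval, and one-sided limits at every point. -/
def PiecewiseContinuousOnPos (f : ℝ → ℝ) : Prop :=
  (∀ T : ℝ, {s : ℝ | 0 < s ∧ s ≤ T ∧ ¬ ContinuousAt f s}.Finite) ∧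
  ∀ s : ℝ, 0 < s →
    (∃ y : ℝ, Filter.Tendsto f (nhdsWithin s (Set.Iio s)) (nhds y)) ∧
    ∃ y : ℝ, Filter.Tendsto f (nhdsWithin s (Set.Ioi s)) (nhds y)

/-- Index set of the subprocesses: `p` observed ones (`Sum.inl`) and `q` latent ones (`Sum.inr`). -/
abbrev Subprocess (p q : ℕ) : Type := Fin p ⊕ Fin q

/-- The data of a stationary partially observed multivariate Hawkes process with `p` observed and
`q` latent subprocesses. `excitation i j` is `φ_ij`, the influence of type-`j` events on the
intensity of type-`i` events. Cycles and self-loops are allowed. -/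
structure HawkesModel (p q : ℕ) where
  /-- background intensities `μ_i` -/
  background : Subprocess p q → ℝ
  /-- excitation functions `φ_ij` -/
  excitation : Subprocess p q → Subprocess p q → ℝ → ℝ
  background_nonneg : ∀ i, 0 ≤ background i
  excitation_nonneg : ∀ i j s, 0 < s → 0 ≤ excitation i j s
  excitation_piecewise : ∀ i j, PiecewiseContinuousOnPos (excitation i j)
  excitation_integrable : ∀ i j, MeasureTheory.IntegrableOn (excitation i j) (Set.Ioi 0)
  /-- stationarity: the influence matrix `Φ_ij = ∫₀^∞ φ_ij` has spectral radius less than one -/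
  stationary : spectralRadius ℂ
    (Matrix.of fun i j : Subprocess p q => ((∫ s in Set.Ioi (0 : ℝ), excitation i j s : ℝ) : ℂ)) < 1

/-- The excitation coefficient `θ_ij^(k) = ∫_{(k-1)Δ}^{kΔ} φ_ij(s) ds`, for `k ≥ 1`. -/
noncomputable def HawkesModel.coeff {p q : ℕ} (H : HawkesModel p q) (Δ : ℝ)
    (i j : Subprocess p q) (k : ℕ) : ℝ :=
  ∫ s in (((k : ℝ) - 1) * Δ)..((k : ℝ) * Δ), H.excitation i j s

/-- The variable `N_i^(n)`, `n = 1, 2, …`, as a node of the window causal graph. (`N_i^(0) = 0` is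
a constant, not a variable.) -/
abbrev WindowVar (p q : ℕ) : Type := Subprocess p q × ℕ+

/-- The window causal graph: there is an edge `N_j^(n-k) → N_i^(n)`, `k ≥ 1`, iff the lagged count
`N_j^(n-k)` enters the equation of `N_i^(n)` with a nonzero coefficient `θ_ij^(k)`. -/
def HawkesModel.windowGraph {p q : ℕ} (H : HawkesModel p q) (Δ : ℝ) : Digraph (WindowVar p q) where
  Adj v w := v.2 < w.2 ∧ H.coeff Δ w.1 v.1 ((w.2 : ℕ) - (v.2 : ℕ)) ≠ 0

/-- The discretized counts `N i n = N_i^(n)` follow the linear autoregressive structural model of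
`H` with bin width `Δ`,
`N_i^(n) = ∑_j ∑_{k=1}^n θ_ij^(k) N_j^(n-k) + ε_i^(n) + Δ μ_i` for `n ≥ 1`, `N_i^(0) = 0`,
where the noise is centred, square integrable, nondegenerate, and uncorrelated between
different variables. -/
structure IsLinearModel {p q : ℕ} (H : HawkesModel p q) (Δ : ℝ)
    {Ω : Type*} [MeasurableSpace Ω] (P : MeasureTheory.Measure Ω)
    (N ε : Subprocess p q → ℕ → Ω → ℝ) : Prop where
  initial : ∀ i, ∀ᵐ ω ∂P, N i 0 ω = 0
  equation : ∀ i, ∀ n : ℕ, 1 ≤ n → ∀ᵐ ω ∂P,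
    N i n ω = (∑ j, ∑ k ∈ Finset.Icc 1 n, H.coeff Δ i j k * N j (n - k) ω)
      + ε i n ω + Δ * H.background i
  noise_memLp : ∀ i, ∀ n : ℕ, 1 ≤ n → MeasureTheory.MemLp (ε i n) 2 P
  noise_mean : ∀ i, ∀ n : ℕ, 1 ≤ n → ∫ ω, ε i n ω ∂P = 0
  noise_variance : ∀ i, ∀ n : ℕ, 1 ≤ n → 0 < ProbabilityTheory.variance (ε i n) P
  noise_uncorrelated : ∀ i j, ∀ n m : ℕ, 1 ≤ n → 1 ≤ m → (i, n) ≠ (j, m) →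
    ProbabilityTheory.covariance (ε i n) (ε j m) P = 0

/-- The cross-covariance matrix `Σ_{R,S}` of two finite sets of variables. -/
noncomputable def crossCov {p q : ℕ} {Ω : Type*} [MeasurableSpace Ω]
    (P : MeasureTheory.Measure Ω) (N : Subprocess p q → ℕ → Ω → ℝ)
    (R S : Finset (WindowVar p q)) : Matrix R S ℝ :=
  Matrix.of fun r s =>
    ProbabilityTheory.covariance (N r.1.1 (r.1.2 : ℕ)) (N s.1.1 (s.1.2 : ℕ)) P

/-- `l` is a (not necessarily directed) path from `a` to `b`: distinct vertices, consecutive ones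
joined by an edge in one direction or the other. -/
def IsUndirectedPath {V : Type*} (G : Digraph V) (a b : V) (l : List V) : Prop :=
  l.head? = some a ∧ l.getLast? = some b ∧ l.Nodup ∧
    l.IsChain (fun u v => G.Adj u v ∨ G.Adj v u)

/-- A path is blocked by `C` if it has an inner vertex `v` which is a non-collider in `C`, or a
collider (`u → v ← w`) such that neither `v` nor any descendant of `v` is in `C`. -/
def IsBlocked {V : Type*} (G : Digraph V) (C : Set V) (l : List V) : Prop :=
  ∃ u v w : V, [u, v, w] <:+: l ∧
    ((¬ (G.Adj u v ∧ G.Adj w v) ∧ v ∈ C) ∨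
      ((G.Adj u v ∧ G.Adj w v) ∧ ∀ d, Relation.ReflTransGen G.Adj v d → d ∉ C))

/-- `C` d-separates `A` and `B` in the directed acyclic graph `G`. -/
def DSeparates {V : Type*} (G : Digraph V) (C A B : Set V) : Prop :=
  ∀ a ∈ A, ∀ b ∈ B, ∀ l : List V, IsUndirectedPath G a b l → IsBlocked G C l

/-- Rank faithfulness: every rank constraint `rank Σ_{R,S} ≤ r` on a sub-cross-covariance matrix
that holds for the given distribution holds for every linear structural model of a partially
observed multivariate Hawkes process with the same window causal graph. -/
def RankFaithful {p q : ℕ} (H : HawkesModel p q) (Δ : ℝ)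
    {Ω : Type*} [MeasurableSpace Ω] (P : MeasureTheory.Measure Ω)
    (N : Subprocess p q → ℕ → Ω → ℝ) : Prop :=
  ∀ (R S : Finset (WindowVar p q)) (r : ℕ), (crossCov P N R S).rank ≤ r →
    ∀ (H' : HawkesModel p q), H'.windowGraph Δ = H.windowGraph Δ →
    ∀ (Ω' : Type) [MeasurableSpace Ω'] (P' : MeasureTheory.Measure Ω')
      [MeasureTheory.IsProbabilityMeasure P'] (N' ε' : Subprocess p q → ℕ → Ω' → ℝ),
      IsLinearModel H' Δ P' N' ε' → (crossCov P' N' R S).rank ≤ r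

end POMHP

/-! Solving the recursion writes every count, up to a constant, as a sum of noise terms weighted by
directed paths. Covariances are therefore inner products of path-weight rows
(`IsLinearModel.covariance_eq`). On the graph side, an open path from `a` to `b` exists iff there is
a chain of links from `a` to `b` with inner points in `C`; a link is a common source reaching both
of its ends by directed paths that meet `C` at most at their ends (`dSeparates_iff`).

The `C × C` covariance block is always nonsingular, so the rank is at least `|C|`. Deleting the
edges out of `C` changes rows only by combinations of rows of `C`, and afterwards the rows of
unlinked vertices are orthogonal. If no chain joins `a` to `B`, it follows that modulo the rows of
`C` the row of `a` is orthogonal to all rows of `B ∪ C` (`exists_modelCov_eq_sum`), and the rank is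
at most `|C|`.

If a chain exists, take a shortest one, a source for each link, and each element of `C` off the
chain as its own source. After deletion of the edges out of `C`, absence of chords makes the
path-weight matrices from these sources to `C ∪ {a}` and to `C ∪ {b}` triangular, and nonnegativity
of the weights prevents cancellation (`Connects.exists_sources`). Noise concentrated at the sources
would factor the covariance minor into these two matrices; a small positive variance elsewhere keeps
it nonzero (`Connects.exists_variances`). Only the noise varies, never the excitation, so both
converses follow from models of the given process itself. -/

namespace POMHP

/-! ### d-separation as absence of chains of links -/

section Graph

open Relation

variable {V : Type*} (G : Digraph V) (C : Set V)

/-- An edge `u → v` of `G` whose tail is not in `C`. -/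
def AvoidStep (u v : V) : Prop := G.Adj u v ∧ u ∉ C

/-- `v` is reached from `u` by a directed path all of whose vertices except possibly the last one
avoid `C`. -/
def Reaches : V → V → Prop := ReflTransGen (AvoidStep G C)

/-- `z` and `z'` are reached from a common source. -/
def Linked (z z' : V) : Prop := ∃ u, Reaches G C u z ∧ Reaches G C u z'

/-- `z` is obtained from `a` by successive links through elements of `C`. -/
def LinkedThrough : V → V → Prop := ReflTransGen fun z z' => Linked G C z z' ∧ z' ∈ C

/-- `a` and `b` are joined by links whose inner vertices belong to `C`. -/
def Connects (a b : V) : Prop := ∃ z, LinkedThrough G C a z ∧ Linked G C z b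

/-- The triple `u, v, w` does not block a walk at `v`. -/
def TripleOpen (u v w : V) : Prop :=
  (G.Adj u v ∧ G.Adj w v → ∃ d, ReflTransGen G.Adj v d ∧ d ∈ C) ∧
    (¬ (G.Adj u v ∧ G.Adj w v) → v ∉ C)

/-- A walk in the underlying undirected graph that is not blocked by `C`. -/
def IsActive (l : List V) : Prop :=
  l.IsChain (fun u v => G.Adj u v ∨ G.Adj v u) ∧
    ∀ u v w, [u, v, w] <:+: l → TripleOpen G C u v w

variable {G C}

lemma not_isBlocked_iff {l : List V} :
    ¬ IsBlocked G C l ↔ ∀ u v w, [u, v, w] <:+: l → TripleOpen G C u v w := by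
  unfold IsBlocked TripleOpen
  push Not
  refine forall_congr' fun u => forall_congr' fun v => forall_congr' fun w =>
    imp_congr_right fun _ => ?_
  tauto

lemma Linked.symm {z z' : V} (h : Linked G C z z') : Linked G C z' z :=
  h.imp fun _ => And.symm

lemma Reaches.eq_of_mem {u v : V} (h : Reaches G C u v) (hu : u ∈ C) : u = v := by
  rcases ReflTransGen.cases_head h with h | ⟨w, h, -⟩
  · exact h
  · exact absurd hu h.2

/-- Stop the directed path at its first element of `C`. -/
lemma exists_reaches_mem {v d : V} (h : ReflTransGen G.Adj v d) (hd : d ∈ C) :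
    ∃ z ∈ C, Reaches G C v z := by
  induction h using ReflTransGen.head_induction_on with
  | refl => exact ⟨d, hd, .refl⟩
  | @head u w huw _ ih =>
    by_cases hu : u ∈ C
    · exact ⟨u, hu, .refl⟩
    · obtain ⟨z, hz, hwz⟩ := ih
      exact ⟨z, hz, .head ⟨huw, hu⟩ hwz⟩

lemma IsActive.of_infix {l l' : List V} (h : IsActive G C l) (hl : l' <:+: l) :
    IsActive G C l' :=
  ⟨h.1.infix hl, fun u v w huvw => h.2 u v w (huvw.trans hl)⟩

lemma IsActive.cons {v w : V} {rest : List V} (h : IsActive G C (v :: rest))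
    (hvw : G.Adj w v ∨ G.Adj v w) (hopen : ∀ x rest', rest = x :: rest' → TripleOpen G C w v x) :
    IsActive G C (w :: v :: rest) := by
  refine ⟨List.isChain_cons_cons.2 ⟨hvw, h.1⟩, fun x y z hxyz => ?_⟩
  rcases List.infix_cons_iff.1 hxyz with hp | hi
  · obtain ⟨s, hs⟩ := hp
    simp only [List.cons_append, List.nil_append, List.cons.injEq] at hs
    obtain ⟨rfl, rfl, hs⟩ := hs
    exact hopen z s hs.symm
  · exact h.2 x y z hi

/-- A walk that starts forwards along an edge and finishes backwards along one has to turn around.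
Its first turn is a collider descending from `v`, and activity gives that collider a descendant in
`C`. -/
lemma exists_descendant_of_isActive (hG : ∀ v w, G.Adj v w → ¬ G.Adj w v) {x e : V}
    (hxe : G.Adj e x) (rest : List V) :
    ∀ v w, G.Adj v w → IsActive G C (v :: w :: rest) → [x, e] <:+ v :: w :: rest →
      ∃ d, ReflTransGen G.Adj v d ∧ d ∈ C := by
  induction rest with
  | nil =>
    intro v w hvw _ hs
    have := hs.eq_of_length rfl
    simp only [List.cons.injEq, and_true] at this
    obtain ⟨rfl, rfl⟩ := this
    exact absurd hxe (hG _ _ hvw)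
  | cons y rest ih =>
    intro v w hvw hact hs
    have hs' : [x, e] <:+ w :: y :: rest := by
      rcases List.suffix_cons_iff.1 hs with h | h
      · simp at h
      · exact h
    obtain ⟨d, hd, hdC⟩ : ∃ d, ReflTransGen G.Adj w d ∧ d ∈ C := by
      by_cases hyw : G.Adj y w
      · exact (hact.2 v w y ⟨[], rest, by simp⟩).1 ⟨hvw, hyw⟩
      · have hact' : IsActive G C (w :: y :: rest) := hact.of_infix ⟨[v], [], by simp⟩
        exact ih w y ((List.isChain_cons_cons.1 hact'.1).1.resolve_right hyw) hact' hs'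
    exact ⟨d, .head hvw hd, hdC⟩

lemma infix_append_cons {u v w m : V} {p r : List V} (h : [u, v, w] <:+: p ++ m :: r) :
    [u, v, w] <:+: p ++ [m] ∨ [u, v, w] <:+: m :: r ∨
      ∃ s r', p = s ++ [u] ∧ v = m ∧ r = w :: r' := by
  obtain ⟨s, t, h⟩ := h
  rw [List.append_assoc] at h
  rcases List.append_eq_append_iff.1 h with ⟨a, ha, hb⟩ | ⟨c, -, hc⟩
  · match a, ha, hb with
    | [], ha, hb => exact .inr (.inl ⟨[], t, by simpa using hb⟩)
    | [u'], ha, hb =>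
      simp only [List.cons_append, List.nil_append, List.cons.injEq] at hb
      obtain ⟨rfl, rfl, rfl⟩ := hb
      exact .inr (.inr ⟨s, t, ha, rfl, rfl⟩)
    | [u', v'], ha, hb =>
      simp only [List.cons_append, List.nil_append, List.cons.injEq] at hb
      obtain ⟨rfl, rfl, rfl, rfl⟩ := hb
      exact .inl ⟨s, [], by simp [ha]⟩
    | u' :: v' :: w' :: a', ha, hb =>
      simp only [List.cons_append, List.nil_append, List.cons.injEq] at hb
      obtain ⟨rfl, rfl, rfl, -⟩ := hb
      exact .inl ⟨s, a' ++ [m], by simp [ha]⟩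
  · exact .inr (.inl ⟨c, t, by simp [hc]⟩)

/-- Loops can be cut out of active walks; only the new triple at `v` needs an argument. If it is a
non-collider, so was one of the two old triples at `v`. If it is a collider and neither old triple
was, the loop leaves `v` forwards and returns backwards, so it contains an open collider below `v`.
-/
lemma IsActive.cut (hG : ∀ v w, G.Adj v w → ¬ G.Adj w v) {p q r : List V} {v : V}
    (h : IsActive G C (p ++ v :: (q ++ v :: r))) : IsActive G C (p ++ v :: r) := by
  have h1 : IsActive G C (p ++ [v]) := h.of_infix ⟨[], q ++ v :: r, by simp⟩
  have h2 : IsActive G C (v :: r) := h.of_infix ⟨p ++ v :: q, [], by simp⟩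
  refine ⟨List.isChain_split.2 ⟨h1.1, h2.1⟩, fun u x w huxw => ?_⟩
  rcases infix_append_cons huxw with h' | h' | ⟨s, r', rfl, rfl, rfl⟩
  · exact h1.2 _ _ _ h'
  · exact h2.2 _ _ _ h'
  have hq : IsActive G C (x :: (q ++ [x])) := h.of_infix ⟨s ++ [u], w :: r', by simp⟩
  have hne : q ≠ [] := by
    rintro rfl
    have := (List.isChain_cons_cons.1 hq.1).1
    exact hG x x (this.elim id id) (this.elim id id)
  obtain ⟨y, q', hyq⟩ := List.exists_cons_of_ne_nil hne
  obtain ⟨q'', z, hqz⟩ := (List.eq_nil_or_concat q).resolve_left hne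
  have o1 : TripleOpen G C u x y :=
    h.2 _ _ _ ⟨s, q' ++ x :: w :: r', by simp [hyq]⟩
  have o2 : TripleOpen G C z x w :=
    h.2 _ _ _ ⟨s ++ u :: x :: q'', r', by simp [hqz]⟩
  refine ⟨fun ⟨hux, hwx⟩ => ?_, fun hn => ?_⟩
  · by_cases hyx : G.Adj y x
    · exact o1.1 ⟨hux, hyx⟩
    by_cases hzx : G.Adj z x
    · exact o2.1 ⟨hzx, hwx⟩
    have hxz : G.Adj x z := by
      have : IsActive G C [z, x] := hq.of_infix ⟨x :: q'', [], by simp [hqz]⟩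
      exact (List.isChain_cons_cons.1 this.1).1.resolve_left hzx
    rw [hyq] at hq
    exact exists_descendant_of_isActive hG hxz (q' ++ [x]) x y
      ((List.isChain_cons_cons.1 hq.1).1.resolve_right hyx) hq
      ⟨x :: q'', by rw [← List.cons_append, ← hyq, hqz]; simp⟩
  · by_cases hux : G.Adj u x
    · exact o2.2 fun h => hn ⟨hux, h.2⟩
    · exact o1.2 fun h => hux h.1

lemma exists_repetition {l : List V} (h : ¬ l.Nodup) :
    ∃ p q r v, l = p ++ v :: (q ++ v :: r) := by
  induction l with
  | nil => simp at h
  | cons x l ih =>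
    by_cases hx : x ∈ l
    · obtain ⟨q, r, rfl⟩ := List.append_of_mem hx
      exact ⟨[], q, r, x, rfl⟩
    · obtain ⟨p, q, r, v, rfl⟩ := ih fun hl => h (List.nodup_cons.2 ⟨hx, hl⟩)
      exact ⟨x :: p, q, r, v, rfl⟩

lemma exists_path_of_isActive (hG : ∀ v w, G.Adj v w → ¬ G.Adj w v) {a b : V} (n : ℕ) :
    ∀ l : List V, l.length = n → IsActive G C l → l.head? = some a → l.getLast? = some b →
      ∃ l', IsUndirectedPath G a b l' ∧ ¬ IsBlocked G C l' := by
  induction n using Nat.strong_induction_on with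
  | _ n ih =>
    intro l hn hl ha hb
    by_cases hd : l.Nodup
    · exact ⟨l, ⟨ha, hb, hd, hl.1⟩, not_isBlocked_iff.2 hl.2⟩
    · obtain ⟨p, q, r, v, rfl⟩ := exists_repetition hd
      refine ih _ ?_ (p ++ v :: r) rfl (hl.cut hG) ?_ ?_
      · rw [← hn]; simp
      · cases p <;> simpa using ha
      · simpa [List.getLast?_append, List.getLast?_cons] using hb

/-! ### Building an active walk from a chain of links -/

/-- The active walks from `v` to `b` which can be extended at `v` in either direction, and which do
not arrive at `v` along an edge pointing to `v`. -/
def TailState (G : Digraph V) (C : Set V) (b v : V) : Prop :=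
  v ∉ C ∧ ∃ rest, IsActive G C (v :: rest) ∧ (v :: rest).getLast? = some b ∧
    ∀ x rest', rest = x :: rest' → ¬ G.Adj x v

/-- There is an active walk from `v` to `b` whose edge at `v` points to `v`. -/
def HeadState (G : Digraph V) (C : Set V) (b v : V) : Prop :=
  ∃ x rest, IsActive G C (v :: x :: rest) ∧ (v :: x :: rest).getLast? = some b ∧ G.Adj x v

lemma TailState.step_up (hG : ∀ v w, G.Adj v w → ¬ G.Adj w v) {b v w : V}
    (h : TailState G C b v) (hwv : AvoidStep G C w v) : TailState G C b w := by
  obtain ⟨hv, rest, hact, hlast, hx⟩ := h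
  refine ⟨hwv.2, v :: rest, hact.cons (.inl hwv.1) fun x rest' hr => ?_, by simpa using hlast, ?_⟩
  · exact ⟨fun h => absurd h.2 (hx x rest' hr), fun _ => hv⟩
  · intro x rest' hr
    obtain ⟨rfl, -⟩ := List.cons.inj hr
    exact hG _ _ hwv.1

lemma TailState.up (hG : ∀ v w, G.Adj v w → ¬ G.Adj w v) {b v s : V}
    (h : TailState G C b v) (hs : Reaches G C s v) : TailState G C b s := by
  induction hs using ReflTransGen.head_induction_on with
  | refl => exact h
  | head hst _ ih => exact ih.step_up hG hst

/-- Climbing from `v ∈ C` to a different source makes `v` a collider, which is open because it lies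
in `C` itself. -/
lemma HeadState.up (hG : ∀ v w, G.Adj v w → ¬ G.Adj w v) {b v s : V}
    (h : HeadState G C b v) (hv : v ∈ C) (hs : Reaches G C s v) : s = v ∨ TailState G C b s := by
  rcases ReflTransGen.cases_tail hs with hs | ⟨w, hsw, hwv⟩
  · exact .inl hs.symm
  refine .inr (TailState.up hG ?_ hsw)
  obtain ⟨x, rest, hact, hlast, hx⟩ := h
  refine ⟨hwv.2, v :: x :: rest, hact.cons (.inl hwv.1) fun x' rest' hr => ?_,
    by simpa using hlast, ?_⟩
  · obtain ⟨rfl, -⟩ := List.cons.inj hr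
    exact ⟨fun _ => ⟨v, .refl, hv⟩, fun h => absurd ⟨hwv.1, hx⟩ h⟩
  · intro x' rest' hr
    obtain ⟨rfl, -⟩ := List.cons.inj hr
    exact hG _ _ hwv.1

lemma HeadState.of_step (hG : ∀ v w, G.Adj v w → ¬ G.Adj w v) {b v w : V}
    (h : TailState G C b v ∨ HeadState G C b v) (hvw : AvoidStep G C v w) :
    HeadState G C b w := by
  obtain ⟨rest, hact, hlast⟩ : ∃ rest, IsActive G C (v :: rest) ∧
      (v :: rest).getLast? = some b := by
    rcases h with ⟨-, rest, h1, h2, -⟩ | ⟨x, rest, h1, h2, -⟩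
    exacts [⟨_, h1, h2⟩, ⟨_, h1, h2⟩]
  exact ⟨v, rest, hact.cons (.inr hvw.1) fun x rest' _ =>
    ⟨fun h => absurd h.1 (hG _ _ hvw.1), fun _ => hvw.2⟩, by simpa using hlast, hvw.1⟩

lemma TailState.down (hG : ∀ v w, G.Adj v w → ¬ G.Adj w v) {b s z : V}
    (h : TailState G C b s) (hs : Reaches G C s z) : s = z ∨ HeadState G C b z := by
  induction hs with
  | refl => exact .inl rfl
  | tail _ hst ih =>
    rcases ih with rfl | ih
    · exact .inr (HeadState.of_step hG (.inl h) hst)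
    · exact .inr (HeadState.of_step hG (.inr ih) hst)

/-- The walk grows from `b` link by link: up to the common source, then down to the next element of
`C`, which is entered by an incoming edge. An element of `C` is a source only of itself, so a link
with such a source is trivial. -/
lemma states_of_linkedThrough (hG : ∀ v w, G.Adj v w → ¬ G.Adj w v) {b z : V} (hb : b ∉ C)
    (h : LinkedThrough G C b z) :
    (z = b ∧ TailState G C b z) ∨ (z ∈ C ∧ HeadState G C b z) := by
  induction h with
  | refl => exact .inl ⟨rfl, hb, [], ⟨by simp, fun u v w h => by simpa using h.length_le⟩, by simp⟩
  | @tail z z' _ hlink ih =>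
    obtain ⟨⟨s, hsz, hsz'⟩, hz'⟩ := hlink
    refine .inr ⟨hz', ?_⟩
    have key : TailState G C b s → HeadState G C b z' := fun hs => by
      rcases hs.down hG hsz' with rfl | h
      · exact absurd hz' hs.1
      · exact h
    rcases ih with ⟨-, h⟩ | ⟨hz, h⟩
    · exact key (h.up hG hsz)
    · rcases h.up hG hz hsz with rfl | hs
      · rwa [← hsz'.eq_of_mem hz]
      · exact key hs

lemma exists_isActive_of_connects (hG : ∀ v w, G.Adj v w → ¬ G.Adj w v) {a b : V} (ha : a ∉ C)
    (hb : b ∉ C) (h : Connects G C b a) :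
    ∃ l, IsActive G C l ∧ l.head? = some a ∧ l.getLast? = some b := by
  obtain ⟨z, hz, s, hsz, hsa⟩ := h
  have hs : TailState G C b s := by
    rcases states_of_linkedThrough hG hb hz with ⟨-, h⟩ | ⟨hzC, h⟩
    · exact h.up hG hsz
    · rcases h.up hG hzC hsz with rfl | hs
      · exact absurd (hsa.eq_of_mem hzC ▸ hzC) ha
      · exact hs
  rcases hs.down hG hsa with rfl | ⟨x, rest, h1, h2, -⟩
  · obtain ⟨-, rest, h1, h2, -⟩ := hs
    exact ⟨_, h1, rfl, h2⟩
  · exact ⟨_, h1, rfl, h2⟩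

/-- The walk is read from its start with an anchor `z`, which is `a` or an element of `C` already
joined to `a`. The current vertex stays linked to `z`, and while the walk runs against the arrows it
even reaches `z`. -/
lemma linkedThrough_of_isActive (hG : ∀ v w, G.Adj v w → ¬ G.Adj w v) {a b : V}
    (hb : b ∉ C) (rest : List V) :
    ∀ u v, IsActive G C (u :: v :: rest) → (u :: v :: rest).getLast? = some b →
      (∃ z, LinkedThrough G C a z ∧ Linked G C z v ∧ (¬ G.Adj u v → Reaches G C v z)) →
      Connects G C a b := by
  induction rest with
  | nil =>
    rintro u v - hlast ⟨z, hz, hzv, -⟩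
    simp only [List.getLast?_cons_cons, List.getLast?_singleton, Option.some.injEq] at hlast
    exact hlast ▸ ⟨z, hz, hzv⟩
  | cons w rest ih =>
    rintro u v hact hlast ⟨z, hz, hzv, hr⟩
    have hact' : IsActive G C (v :: w :: rest) := hact.of_infix ⟨[u], [], by simp⟩
    have hopen : TripleOpen G C u v w := hact.2 _ _ _ ⟨[], rest, by simp⟩
    refine ih v w hact' (by simpa using hlast) ?_
    rcases (List.isChain_cons_cons.1 hact'.1).1 with hvw | hwv
    · obtain ⟨s, hsz, hsv⟩ := hzv
      exact ⟨z, hz, ⟨s, hsz, hsv.tail ⟨hvw, hopen.2 fun h => hG _ _ hvw h.2⟩⟩,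
        fun h => absurd hvw h⟩
    · have hw : w ∉ C := by
        cases rest with
        | nil =>
          simp only [List.getLast?_cons_cons, List.getLast?_singleton, Option.some.injEq] at hlast
          exact hlast ▸ hb
        | cons x rest =>
          exact (hact'.2 v w x ⟨[], rest, by simp⟩).2 fun h => hG _ _ hwv h.1
      by_cases huv : G.Adj u v
      -- At an open collider the anchor moves to the first element of `C` below it; both
      -- neighbouring branches reach that element.
      · obtain ⟨d, hvd, hd⟩ := hopen.1 ⟨huv, hwv⟩
        obtain ⟨z', hz', hvz'⟩ := exists_reaches_mem hvd hd
        obtain ⟨s, hsz, hsv⟩ := hzv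
        have hwz' : Reaches G C w z' := .head ⟨hwv, hw⟩ hvz'
        exact ⟨z', hz.tail ⟨⟨s, hsz, hsv.trans hvz'⟩, hz'⟩, ⟨w, hwz', .refl⟩, fun _ => hwz'⟩
      · have hwz : Reaches G C w z := .head ⟨hwv, hw⟩ (hr huv)
        exact ⟨z, hz, ⟨w, hwz, .refl⟩, fun _ => hwz⟩

lemma connects_of_not_isBlocked (hG : ∀ v w, G.Adj v w → ¬ G.Adj w v) {a b : V} {l : List V}
    (ha : a ∉ C) (hb : b ∉ C) (hab : a ≠ b) (hl : IsUndirectedPath G a b l)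
    (hn : ¬ IsBlocked G C l) : Connects G C a b := by
  obtain ⟨h1, h2, -, h4⟩ := hl
  have hact : IsActive G C l := ⟨h4, not_isBlocked_iff.1 hn⟩
  match l, h1, h2, hact with
  | [a'], h1, h2, _ =>
    simp only [List.head?_cons, List.getLast?_singleton, Option.some.injEq] at h1 h2
    exact absurd (h1.symm.trans h2) hab
  | a' :: v :: rest, h1, h2, hact =>
    simp only [List.head?_cons, Option.some.injEq] at h1
    subst h1
    refine linkedThrough_of_isActive hG hb rest a' v hact h2 ⟨a', .refl, ?_⟩
    by_cases hav : G.Adj a' v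
    · exact ⟨⟨a', .refl, .single ⟨hav, ha⟩⟩, fun h => absurd hav h⟩
    · have hva := (List.isChain_cons_cons.1 hact.1).1.resolve_left hav
      have hv : v ∉ C := by
        cases rest with
        | nil =>
          simp only [List.getLast?_cons_cons, List.getLast?_singleton, Option.some.injEq] at h2
          exact h2 ▸ hb
        | cons x rest => exact (hact.2 a' v x ⟨[], rest, by simp⟩).2 fun h => hav h.1
      have : Reaches G C v a' := .single ⟨hva, hv⟩
      exact ⟨⟨v, this, .refl⟩, fun _ => this⟩

/-! ### Shortest chains of links -/

/-- A chain of links from `a` to `b` with inner vertices in `C`, with its number of links. -/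
def IsLinkChain (G : Digraph V) (C : Set V) (a b : V) (n : ℕ) (f : ℕ → V) : Prop :=
  f 0 = a ∧ f n = b ∧ (∀ i < n, Linked G C (f i) (f (i + 1))) ∧ ∀ i, 0 < i → i < n → f i ∈ C

lemma exists_isLinkChain_of_linkedThrough {a z : V} (h : LinkedThrough G C a z) :
    ∃ n f, IsLinkChain G C a z n f ∧ (0 < n → z ∈ C) := by
  induction h with
  | refl => exact ⟨0, fun _ => a, ⟨rfl, rfl, by simp, by simp⟩, by simp⟩
  | @tail z z' _ hl ih =>
    obtain ⟨n, f, ⟨h0, hn, h1, h2⟩, h3⟩ := ih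
    refine ⟨n + 1, fun i => if i ≤ n then f i else z', ⟨by simpa using h0, by simp, ?_, ?_⟩,
      fun _ => hl.2⟩
    · intro i hi
      rcases Nat.lt_succ_iff_lt_or_eq.1 hi with hi | rfl
      · simpa [hi.le, Nat.succ_le_iff.2 hi] using h1 i hi
      · simpa [hn] using hl.1
    · intro i h0 hi
      simp only [Nat.lt_succ_iff.1 hi, if_true]
      rcases Nat.lt_succ_iff_lt_or_eq.1 hi with hi | rfl
      · exact h2 i h0 hi
      · exact hn ▸ h3 h0

lemma Connects.exists_isLinkChain {a b : V} (h : Connects G C a b) :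
    ∃ n f, IsLinkChain G C a b n f := by
  obtain ⟨z, hz, hl⟩ := h
  obtain ⟨n, f, ⟨h0, hn, h1, h2⟩, h3⟩ := exists_isLinkChain_of_linkedThrough hz
  refine ⟨n + 1, fun i => if i ≤ n then f i else b, by simpa using h0, by simp, ?_, ?_⟩
  · intro i hi
    rcases Nat.lt_succ_iff_lt_or_eq.1 hi with hi | rfl
    · simpa [hi.le, Nat.succ_le_iff.2 hi] using h1 i hi
    · simpa [hn] using hl
  · intro i h0 hi
    simp only [Nat.lt_succ_iff.1 hi, if_true]
    rcases Nat.lt_succ_iff_lt_or_eq.1 hi with hi | rfl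
    · exact h2 i h0 hi
    · exact hn ▸ h3 h0

lemma IsLinkChain.shortcut {a b : V} {n : ℕ} {f : ℕ → V} (h : IsLinkChain G C a b n f) {i k : ℕ}
    (hi : i + 1 + k ≤ n) (hl : Linked G C (f i) (f (i + 1 + k))) :
    IsLinkChain G C a b (n - k) fun j => if j ≤ i then f j else f (j + k) := by
  obtain ⟨h0, hn, h1, h2⟩ := h
  refine ⟨by simpa using h0, ?_, fun j hj => ?_, fun j hj0 hj => ?_⟩
  · simp only [if_neg (show ¬ n - k ≤ i by omega), Nat.sub_add_cancel (show k ≤ n by omega), hn]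
  · rcases lt_trichotomy j i with hji | rfl | hji
    · simpa [hji.le, Nat.succ_le_iff.2 hji] using h1 j (by omega)
    · simpa using hl
    · simp only [if_neg (show ¬ j ≤ i by omega), if_neg (show ¬ j + 1 ≤ i by omega)]
      rw [show j + 1 + k = j + k + 1 by omega]
      exact h1 _ (by omega)
  · dsimp only
    split_ifs
    exacts [h2 j hj0 (by omega), h2 _ (by omega) (by omega)]

/-- A shortest chain of links has no chords and no repetitions. -/
lemma Connects.exists_chordless {a b : V} (h : Connects G C a b) (hab : a ≠ b) (hb : b ∉ C) :
    ∃ n f, IsLinkChain G C a b n f ∧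
      (∀ i j, i + 1 < j → j ≤ n → ¬ Linked G C (f i) (f j)) ∧
      ∀ i j, i < j → j ≤ n → f i ≠ f j := by
  classical
  have hex := h.exists_isLinkChain
  obtain ⟨f, hf⟩ := Nat.find_spec hex
  have hmin : ∀ i j, i + 1 < j → j ≤ Nat.find hex → ¬ Linked G C (f i) (f j) := by
    intro i j hij hj hl
    obtain ⟨k, rfl⟩ := Nat.exists_eq_add_of_le hij.le
    exact Nat.find_min hex (m := Nat.find hex - k) (by omega) ⟨_, hf.shortcut hj hl⟩
  refine ⟨_, f, hf, hmin, fun i j hij hj he => ?_⟩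
  -- A repetition `f i = f j` with `j < n` turns the link at `j` into a chord from `i` to `j + 1`.
  -- The case `j = n` is excluded by `a ≠ b` and `b ∉ C`.
  rcases hj.lt_or_eq with hj | rfl
  · exact hmin i (j + 1) (by omega) (by omega) (he ▸ hf.2.2.1 j hj)
  · rw [hf.2.1] at he
    rcases Nat.eq_zero_or_pos i with rfl | hi
    · exact hab (hf.1.symm.trans he)
    · exact hb (he ▸ hf.2.2.2 i hi hij)

lemma LinkedThrough.connects_symm {b z : V} (h : LinkedThrough G C b z) :
    ∀ y, Linked G C z y → Connects G C y b := by
  induction h with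
  | refl => exact fun y hy => ⟨y, .refl, hy.symm⟩
  | @tail z z' _ hl ih =>
    intro y hy
    obtain ⟨x, hx, hxb⟩ := ih z' hl.1
    exact ⟨x, .head ⟨hy.symm, hl.2⟩ hx, hxb⟩

lemma Connects.symm {a b : V} (h : Connects G C a b) : Connects G C b a := by
  obtain ⟨z, hz, hl⟩ := h
  exact hz.connects_symm b hl

/-- d-separation in terms of links through directed paths avoiding the separating set. -/
theorem dSeparates_iff (hG : ∀ v w, G.Adj v w → ¬ G.Adj w v) {A B : Set V} (hAB : Disjoint A B)
    (hAC : Disjoint A C) (hBC : Disjoint B C) :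
    DSeparates G C A B ↔ ∀ a ∈ A, ∀ b ∈ B, ¬ Connects G C a b := by
  refine forall₂_congr fun a ha => forall₂_congr fun b hb => ?_
  have haC := Set.disjoint_left.1 hAC ha
  have hbC := Set.disjoint_left.1 hBC hb
  constructor
  · intro h hc
    obtain ⟨l, hl, h1, h2⟩ := exists_isActive_of_connects hG haC hbC hc.symm
    obtain ⟨l', hl', hn⟩ := exists_path_of_isActive hG _ l rfl hl h1 h2
    exact hn (h l' hl')
  · intro h l hl
    by_contra hn
    exact h (connects_of_not_isBlocked hG haC hbC (hAB.ne_of_mem ha hb) hl hn)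

end Graph

/-! ### Path weights and covariances of linear structural models -/

section Algebra

open Relation Matrix

variable {V : Type*} {F C : Finset V} {t : V → ℕ} {θ : V → V → ℝ}

lemma le_of_reaches (ht : ∀ v w, θ v w ≠ 0 → t w < t v) {u v : V}
    (h : ReflTransGen (fun x y => θ y x ≠ 0) u v) : t u ≤ t v := by
  induction h with
  | refl => exact le_rfl
  | tail _ h ih => exact ih.trans (ht _ _ h).le

lemma mem_of_reaches (hF : ∀ v ∈ F, ∀ w, θ v w ≠ 0 → w ∈ F) {u v : V} (hv : v ∈ F)
    (h : ReflTransGen (fun x y => θ y x ≠ 0) u v) : u ∈ F := by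
  induction h using ReflTransGen.head_induction_on with
  | refl => exact hv
  | head h _ ih => exact hF _ ih _ h

/-- The rows, weighted by the noise standard deviations, as vectors of a Euclidean space. -/
noncomputable def weightedRow (F : Finset V) (d : V → ℝ) : (V → ℝ) →ₗ[ℝ] EuclideanSpace ℝ F where
  toFun x := WithLp.toLp 2 fun u => √(d u) * x u
  map_add' x y := by ext u; simp [mul_add]
  map_smul' c x := by ext u; simp; ring

/-- This makes `modelCov` a Gram matrix, so that orthogonal projection applies to covariances. -/
lemma inner_weightedRow {d : V → ℝ} (hd : ∀ u ∈ F, 0 ≤ d u) (x y : V → ℝ) :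
    inner ℝ (weightedRow F d x) (weightedRow F d y) = ∑ u ∈ F, d u * x u * y u := by
  rw [← Finset.sum_coe_sort F]
  simp only [weightedRow, LinearMap.coe_mk, AddHom.coe_mk, PiLp.inner_apply, RCLike.inner_apply,
    conj_trivial]
  refine Finset.sum_congr rfl fun u _ => ?_
  linear_combination (x u * y u) * Real.mul_self_sqrt (hd u u.2)

/-- The vertex `a` followed by the elements of `C`. -/
def extendBy (C : Finset V) (a : V) (k : Option C) : V := k.elim a (↑)

lemma extendBy_injective {a : V} (ha : a ∉ C) : Function.Injective (extendBy C a) := by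
  rintro (_ | c) (_ | c') h
  · rfl
  · exact absurd ((show a = c' from h) ▸ c'.2) ha
  · exact absurd ((show (c : V) = a from h) ▸ c.2) ha
  · exact congrArg some (Subtype.ext h)

variable [DecidableEq V]

/-- Total weight of the directed paths from `u` to `v` in the graph on `F` with edge weights `θ`,
where `θ v w` is the weight of the edge `w → v`; only edges which increase `t` are used. -/
noncomputable def pathWeight (F : Finset V) (t : V → ℕ) (θ : V → V → ℝ) (v u : V) : ℝ :=
  (if v = u then 1 else 0) +
    ∑ w ∈ F, if _h : t w < t v then θ v w * pathWeight F t θ w u else 0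
termination_by t v

/-- The weights with the edges out of `C` deleted. -/
def avoidWeight (C : Finset V) (θ : V → V → ℝ) (v w : V) : ℝ := if w ∈ C then 0 else θ v w

/-- The covariance of the variables `r` and `s` of the linear structural model with weights `θ`
and noise variances `d`. -/
noncomputable def modelCov (F : Finset V) (t : V → ℕ) (θ : V → V → ℝ) (d : V → ℝ) (r s : V) : ℝ :=
  ∑ u ∈ F, d u * pathWeight F t θ r u * pathWeight F t θ s u

lemma avoidWeight_lt (ht : ∀ v w, θ v w ≠ 0 → t w < t v) (v w : V)
    (h : avoidWeight C θ v w ≠ 0) : t w < t v := by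
  unfold avoidWeight at h
  split_ifs at h with hw
  · exact absurd rfl h
  · exact ht v w h

lemma avoidWeight_nonneg (h0 : ∀ v w, 0 ≤ θ v w) (v w : V) : 0 ≤ avoidWeight C θ v w := by
  unfold avoidWeight
  split_ifs
  exacts [le_rfl, h0 v w]

lemma pathWeight_eq (ht : ∀ v w, θ v w ≠ 0 → t w < t v) (v u : V) :
    pathWeight F t θ v u = (if v = u then 1 else 0) + ∑ w ∈ F, θ v w * pathWeight F t θ w u := by
  rw [pathWeight]
  congr 1
  refine Finset.sum_congr rfl fun w _ => ?_
  split_ifs with h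
  · rfl
  · rw [not_not.1 (mt (ht v w) h), zero_mul]

lemma reaches_of_pathWeight_ne_zero (ht : ∀ v w, θ v w ≠ 0 → t w < t v) {u : V} (n : ℕ) :
    ∀ v, t v = n → pathWeight F t θ v u ≠ 0 → ReflTransGen (fun x y => θ y x ≠ 0) u v := by
  induction n using Nat.strong_induction_on with
  | _ n ih =>
    intro v hv h
    by_cases hvu : v = u
    · exact hvu ▸ .refl
    · rw [pathWeight_eq ht, if_neg hvu, zero_add] at h
      obtain ⟨w, -, hw⟩ := Finset.exists_ne_zero_of_sum_ne_zero h
      have hvw := left_ne_zero_of_mul hw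
      exact .tail (ih _ (hv ▸ ht v w hvw) w rfl (right_ne_zero_of_mul hw)) hvw

lemma pathWeight_nonneg (h0 : ∀ v w, 0 ≤ θ v w) (u : V)
    (n : ℕ) : ∀ v, t v = n → 0 ≤ pathWeight F t θ v u := by
  induction n using Nat.strong_induction_on with
  | _ n ih =>
    intro v hv
    rw [pathWeight]
    refine add_nonneg (by split_ifs <;> norm_num) (Finset.sum_nonneg fun w _ => ?_)
    split_ifs with h
    · exact mul_nonneg (h0 v w) (ih _ (hv ▸ h) w rfl)
    · exact le_rfl

/-- Nonnegative weights cannot cancel, so a single directed path suffices; closure of `F` under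
parents keeps that path inside `F`. -/
lemma pathWeight_pos_of_reaches (ht : ∀ v w, θ v w ≠ 0 → t w < t v) (h0 : ∀ v w, 0 ≤ θ v w)
    (hF : ∀ v ∈ F, ∀ w, θ v w ≠ 0 → w ∈ F) {u v : V} (hv : v ∈ F)
    (h : ReflTransGen (fun x y => θ y x ≠ 0) u v) : 0 < pathWeight F t θ v u := by
  induction h with
  | refl =>
    rw [pathWeight_eq ht, if_pos rfl]
    exact add_pos_of_pos_of_nonneg one_pos (Finset.sum_nonneg fun w _ =>
      mul_nonneg (h0 _ _) (pathWeight_nonneg h0 _ _ w rfl))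
  | @tail w v _ hwv ih =>
    have hw := hF v hv w hwv
    rw [pathWeight_eq ht]
    refine add_pos_of_nonneg_of_pos (by split_ifs <;> norm_num) ?_
    exact Finset.sum_pos' (fun x _ => mul_nonneg (h0 _ _) (pathWeight_nonneg h0 _ _ x rfl))
      ⟨w, hw, mul_pos ((h0 v w).lt_of_ne' hwv) (ih hw)⟩

lemma pathWeight_self (ht : ∀ v w, θ v w ≠ 0 → t w < t v) (v : V) :
    pathWeight F t θ v v = 1 := by
  rw [pathWeight_eq ht, if_pos rfl, Finset.sum_eq_zero, add_zero]
  intro w _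
  by_contra h
  have h1 := ht v w (left_ne_zero_of_mul h)
  have h2 := reaches_of_pathWeight_ne_zero ht _ w rfl (right_ne_zero_of_mul h)
  have h3 := le_of_reaches ht h2
  omega

lemma pathWeight_eq_zero_of_le (ht : ∀ v w, θ v w ≠ 0 → t w < t v) {u v : V} (huv : v ≠ u)
    (h : t v ≤ t u) : pathWeight F t θ v u = 0 := by
  by_contra hne
  rcases ReflTransGen.cases_tail (reaches_of_pathWeight_ne_zero ht _ v rfl hne) with h' | ⟨w, h1, h2⟩
  · exact huv h'
  · have h3 := le_of_reaches ht h1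
    have := ht _ _ h2
    omega

/-- Deleting the edges out of `C` changes the row of `v` by a combination of rows of earlier
elements of `C`. -/
lemma pathWeight_sub_avoid_mem_span (ht : ∀ v w, θ v w ≠ 0 → t w < t v) (n : ℕ) :
    ∀ v, t v = n → pathWeight F t θ v - pathWeight F t (avoidWeight C θ) v ∈
      Submodule.span ℝ (pathWeight F t θ '' {c | c ∈ C ∧ t c < t v}) := by
  induction n using Nat.strong_induction_on with
  | _ n ih =>
    intro v hv
    have : pathWeight F t θ v - pathWeight F t (avoidWeight C θ) v = ∑ w ∈ F,
        (θ v w • pathWeight F t θ w -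
          avoidWeight C θ v w • pathWeight F t (avoidWeight C θ) w) := by
      ext u
      simp only [Pi.sub_apply, Finset.sum_apply, Pi.smul_apply, smul_eq_mul,
        Finset.sum_sub_distrib]
      rw [pathWeight_eq ht, pathWeight_eq (avoidWeight_lt ht)]
      ring
    rw [this]
    refine Submodule.sum_mem _ fun w _ => ?_
    by_cases h0 : θ v w = 0
    · simp [avoidWeight, h0]
    have hwv := ht v w h0
    by_cases hw : w ∈ C
    · simp only [avoidWeight, hw, if_true, zero_smul, sub_zero]
      exact Submodule.smul_mem _ _ (Submodule.subset_span
        (Set.mem_image_of_mem _ (show w ∈ {c | c ∈ C ∧ t c < t v} from ⟨hw, hwv⟩)))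
    · simp only [avoidWeight, hw, if_false, ← smul_sub]
      have hsub : {c | c ∈ C ∧ t c < t w} ⊆ {c | c ∈ C ∧ t c < t v} :=
        fun c hc => ⟨hc.1, hc.2.trans hwv⟩
      exact Submodule.smul_mem _ _
        (Submodule.span_mono (Set.image_mono hsub) (ih _ (hv ▸ hwv) w rfl))

variable {G : Digraph V}

lemma reaches_iff_avoidWeight (hG : ∀ v w, G.Adj w v ↔ θ v w ≠ 0) {u v : V} :
    Reaches G C u v ↔ ReflTransGen (fun x y => avoidWeight C θ y x ≠ 0) u v := by
  have : AvoidStep G (C : Set V) = fun x y => avoidWeight C θ y x ≠ 0 := by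
    ext x y
    simp [AvoidStep, avoidWeight, hG, and_comm]
  rw [Reaches, this]

lemma pathWeight_avoid_ne_zero_iff (ht : ∀ v w, θ v w ≠ 0 → t w < t v) (h0 : ∀ v w, 0 ≤ θ v w)
    (hF : ∀ v ∈ F, ∀ w, θ v w ≠ 0 → w ∈ F) (hG : ∀ v w, G.Adj w v ↔ θ v w ≠ 0) {u v : V}
    (hv : v ∈ F) : pathWeight F t (avoidWeight C θ) v u ≠ 0 ↔ Reaches G C u v := by
  rw [reaches_iff_avoidWeight hG]
  refine ⟨reaches_of_pathWeight_ne_zero (avoidWeight_lt ht) _ v rfl, fun h =>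
    (pathWeight_pos_of_reaches (avoidWeight_lt ht) (avoidWeight_nonneg h0) ?_ hv h).ne'⟩
  refine fun v hv w h => hF v hv w fun h' => h ?_
  simp [avoidWeight, h']

/-- If `a` is not connected to `B`, then on `B ∪ C` the covariances with `a` are a combination of
those with the elements of `C`. -/
lemma exists_modelCov_eq_sum (ht : ∀ v w, θ v w ≠ 0 → t w < t v)
    (hG : ∀ v w, G.Adj w v ↔ θ v w ≠ 0)
    {d : V → ℝ} (hd : ∀ u ∈ F, 0 ≤ d u) {a : V} {B : Finset V}
    (hB : ∀ b ∈ B, ¬ Connects G C a b) :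
    ∃ α : C → ℝ, ∀ s ∈ B ∪ C, modelCov F t θ d a s = ∑ c : C, α c * modelCov F t θ d c s := by
  set Φ := weightedRow F d
  set X : V → EuclideanSpace ℝ F := fun v => Φ (pathWeight F t θ v) with hX
  set Y : V → EuclideanSpace ℝ F := fun v => Φ (pathWeight F t (avoidWeight C θ) v) with hY
  have hcov : ∀ r s, modelCov F t θ d r s = inner ℝ (X r) (X s) := fun r s =>
    (inner_weightedRow hd _ _).symm
  have hXY : ∀ v, X v - Y v ∈ Submodule.span ℝ (X '' {c | c ∈ C ∧ t c < t v}) := by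
    intro v
    have := Submodule.mem_map_of_mem (f := Φ)
      (pathWeight_sub_avoid_mem_span (F := F) (C := C) ht _ v rfl)
    rwa [Submodule.map_span, map_sub, ← Set.image_comp] at this
  have hspan : ∀ v, X v - Y v ∈ Submodule.span ℝ (X '' (C : Set V)) := fun v =>
    Submodule.span_mono (Set.image_mono fun c hc => hc.1) (hXY v)
  have horth : ∀ v w, ¬ Linked G (C : Set V) v w → inner ℝ (Y v) (Y w) = (0 : ℝ) := by
    intro v w h
    rw [hY, inner_weightedRow hd]
    refine Finset.sum_eq_zero fun u _ => by_contra fun hne => h ⟨u, ?_, ?_⟩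
    · exact (reaches_iff_avoidWeight hG).2 (reaches_of_pathWeight_ne_zero (avoidWeight_lt ht) _ v rfl
        (right_ne_zero_of_mul (left_ne_zero_of_mul hne)))
    · exact (reaches_iff_avoidWeight hG).2 (reaches_of_pathWeight_ne_zero (avoidWeight_lt ht) _ w rfl
        (right_ne_zero_of_mul hne))
  -- Only the elements of `C` joined to `a` by links are projected away. A vertex linked neither to
  -- them nor to `a` has a row orthogonal to `K` and to `Y a`, hence to the residual `r`.
  set K := Submodule.span ℝ (Y '' {c | c ∈ C ∧ LinkedThrough G C a c})
  obtain ⟨g, hg, r, hr, hgr⟩ := K.exists_add_mem_mem_orthogonal (Y a)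
  have hr' : ∀ v, (∀ z, LinkedThrough G C a z → ¬ Linked G C z v) → inner ℝ r (Y v) = (0 : ℝ) := by
    intro v hv
    have hgv : inner ℝ g (Y v) = (0 : ℝ) := by
      refine Submodule.span_induction (p := fun x _ => inner ℝ x (Y v) = (0 : ℝ)) ?_ (by simp)
        (fun x y _ _ hx hy => by rw [inner_add_left, hx, hy, add_zero])
        (fun c x _ hx => by rw [inner_smul_left, hx, mul_zero]) hg
      rintro _ ⟨c, hc, rfl⟩
      exact horth _ _ (hv c hc.2)
    have := horth a v (hv a .refl)
    rwa [hgr, inner_add_left, hgv, zero_add] at this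
  have hrC : ∀ c ∈ C, inner ℝ r (Y c) = (0 : ℝ) := by
    intro c hc
    by_cases h : LinkedThrough G (C : Set V) a c
    · rw [real_inner_comm]
      exact Submodule.inner_right_of_mem_orthogonal (Submodule.subset_span
        (Set.mem_image_of_mem _ (show c ∈ {c | c ∈ C ∧ LinkedThrough G C a c} from ⟨hc, h⟩))) hr
    · exact hr' c fun z hz hl => h (hz.tail ⟨hl, hc⟩)
  -- `X v - Y v` involves only strictly earlier elements of `C`, so orthogonality to `r` passes from
  -- the rows `Y` to the rows `X` by induction on time.
  have hrX : ∀ v, (∀ c ∈ C, t c < t v → inner ℝ r (X c) = (0 : ℝ)) → inner ℝ r (Y v) = (0 : ℝ) →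
      inner ℝ r (X v) = (0 : ℝ) := by
    intro v h1 h2
    have : inner ℝ r (X v - Y v) = (0 : ℝ) := by
      refine Submodule.span_induction (p := fun x _ => inner ℝ r x = (0 : ℝ)) ?_ (by simp)
        (fun x y _ _ hx hy => by rw [inner_add_right, hx, hy, add_zero])
        (fun c x _ hx => by rw [inner_smul_right, hx, mul_zero]) (hXY v)
      rintro _ ⟨c, hc, rfl⟩
      exact h1 c hc.1 hc.2
    rwa [inner_sub_right, h2, sub_zero] at this
  have hrXC : ∀ n, ∀ c ∈ C, t c = n → inner ℝ r (X c) = (0 : ℝ) := by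
    intro n
    induction n using Nat.strong_induction_on with
    | _ n ih =>
      intro c hc hn
      exact hrX c (fun c' hc' h => ih _ (hn ▸ h) c' hc' rfl) (hrC c hc)
  have hrS : ∀ s ∈ B ∪ C, inner ℝ r (X s) = (0 : ℝ) := by
    intro s hs
    rcases Finset.mem_union.1 hs with hs | hs
    · exact hrX s (fun c hc _ => hrXC _ c hc rfl) (hr' s fun z hz hl => hB s hs ⟨z, hz, hl⟩)
    · exact hrXC _ s hs rfl
  -- Both `X a - Y a` and the projection `g` lie in the span of the rows of `C`. Pairing with `X s`
  -- then removes `r` and leaves the desired combination.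
  have hmem : X a - r ∈ Submodule.span ℝ (X '' (C : Set V)) := by
    have hKX : K ≤ Submodule.span ℝ (X '' (C : Set V)) := by
      refine Submodule.span_le.2 ?_
      rintro _ ⟨c, hc, rfl⟩
      have := Submodule.sub_mem _ (Submodule.subset_span ⟨c, hc.1, rfl⟩ :
        X c ∈ Submodule.span ℝ (X '' (C : Set V))) (hspan c)
      rwa [sub_sub_cancel] at this
    have : X a - r = (X a - Y a) + g := by rw [hgr]; abel
    rw [this]
    exact Submodule.add_mem _ (hspan a) (hKX hg)
  obtain ⟨α, hα⟩ := (Submodule.mem_span_image_finset_iff_exists_fun ℝ).1 hmem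
  refine ⟨α, fun s hs => ?_⟩
  have : X a = ∑ c : C, α c • X c + r := by rw [hα]; abel
  rw [hcov, this, inner_add_left, hrS s hs, add_zero, sum_inner]
  simp only [hcov, inner_smul_left, conj_trivial]

/-- The covariance matrix of `C` is nonsingular. -/
lemma det_modelCov_ne_zero (ht : ∀ v w, θ v w ≠ 0 → t w < t v) {d : V → ℝ}
    (hd : ∀ u ∈ F, 0 < d u) (hC : C ⊆ F) :
    (Matrix.of fun r s : C => modelCov F t θ d r s).det ≠ 0 := by
  intro hdet
  obtain ⟨β, hβ, h⟩ := Matrix.exists_mulVec_eq_zero_iff.2 hdet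
  refine hβ ?_
  -- The quadratic form of the covariance matrix is a sum of squares weighted by the noise
  -- variances.
  have hsum : ∑ u ∈ F, d u * (∑ c : C, β c * pathWeight F t θ c u) ^ 2 = 0 := by
    have h1 : β ⬝ᵥ ((Matrix.of fun r s : C => modelCov F t θ d r s) *ᵥ β) = 0 := by
      rw [h, dotProduct_zero]
    rw [← h1]
    simp only [dotProduct, mulVec, Matrix.of_apply, modelCov, Finset.sum_mul, Finset.mul_sum, sq]
    rw [Finset.sum_comm]
    refine Finset.sum_congr rfl fun i _ => ?_
    rw [Finset.sum_comm]
    refine Finset.sum_congr rfl fun j _ => Finset.sum_congr rfl fun u _ => ?_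
    ring
  have hz : ∀ u ∈ F, ∑ c : C, β c * pathWeight F t θ c u = 0 := by
    intro u hu
    have := (Finset.sum_eq_zero_iff_of_nonneg fun u hu =>
      mul_nonneg (hd u hu).le (sq_nonneg _)).1 hsum u hu
    simpa [(hd u hu).ne'] using this
  by_contra hne
  obtain ⟨c0, hc0⟩ : ∃ c, β c ≠ 0 := by
    by_contra hall
    push Not at hall
    exact hne (funext hall)
  -- The noise of the latest `c` with nonzero coefficient enters no other term of the combination.
  obtain ⟨c, hc, hmax⟩ := Finset.exists_max_image (Finset.univ.filter fun c => β c ≠ 0)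
    (fun c : C => t c) ⟨c0, by simpa using hc0⟩
  have := hz c (hC c.2)
  rw [Finset.sum_eq_single c, pathWeight_self ht, mul_one] at this
  · exact (Finset.mem_filter.1 hc).2 this
  · intro c' _ hcc'
    by_cases h0 : β c' = 0
    · rw [h0, zero_mul]
    · rw [pathWeight_eq_zero_of_le ht (fun h => hcc' (Subtype.ext h)) (hmax c' (by simpa using h0)),
        mul_zero]
  · simp

/-- Forward substitution along `g`: row `τ k` has its pivot in column `k`, and its other nonzero
entries lie in columns of smaller `g`. -/
lemma eq_zero_of_mulVec_eq_zero_of_triangular {κ : Type*} [Fintype κ] [DecidableEq κ]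
    {M : Matrix κ κ ℝ} (τ : κ → κ) (g : κ → ℕ) (h1 : ∀ k, M (τ k) k ≠ 0)
    (h2 : ∀ k k', k' ≠ k → g k ≤ g k' → M (τ k) k' = 0) {β : κ → ℝ} (hβ : M *ᵥ β = 0) :
    β = 0 := by
  have key : ∀ n, ∀ k, g k = n → β k = 0 := by
    intro n
    induction n using Nat.strong_induction_on with
    | _ n ih =>
      intro k hk
      have := congrFun hβ (τ k)
      simp only [mulVec, dotProduct, Pi.zero_apply] at this
      rw [Finset.sum_eq_single k] at this
      · exact (mul_eq_zero.1 this).resolve_left (h1 k)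
      · intro k' _ hkk'
        rcases lt_or_ge (g k') (g k) with h | h
        · rw [ih _ (hk ▸ h) k' rfl, mul_zero]
        · rw [h2 k k' hkk' h, zero_mul]
      · simp
  exact funext fun k => key _ k rfl

/-- Every element of `C` indexes a row. Deleting the edges out of `C` changes rows by combinations
of these, so a kernel vector of the full matrix also kills the reduced one. -/
lemma det_pathWeight_ne_zero {κ : Type*} [Fintype κ] [DecidableEq κ]
    (ht : ∀ v w, θ v w ≠ 0 → t w < t v) (row σ : κ → V) (hrow : ∀ c ∈ C, ∃ k, row k = c)
    (h : ∀ β : κ → ℝ,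
      (Matrix.of fun i j => pathWeight F t (avoidWeight C θ) (row i) (σ j)) *ᵥ β = 0 → β = 0) :
    (Matrix.of fun i j => pathWeight F t θ (row i) (σ j)).det ≠ 0 := by
  intro hdet
  obtain ⟨β, hβ, hz⟩ := Matrix.exists_mulVec_eq_zero_iff.2 hdet
  refine hβ (h β (funext fun i => ?_))
  have hz' : ∀ i, ∑ k, pathWeight F t θ (row i) (σ k) * β k = 0 := fun i => congrFun hz i
  have : ∑ k, (pathWeight F t θ (row i) - pathWeight F t (avoidWeight C θ) (row i)) (σ k) * β k
      = 0 := by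
    refine Submodule.span_induction (p := fun x _ => ∑ k, x (σ k) * β k = 0) ?_ (by simp)
      (fun x y _ _ hx hy => by
        simp only [Pi.add_apply, add_mul, Finset.sum_add_distrib, hx, hy, add_zero])
      (fun c x _ hx => by
        simp only [Pi.smul_apply, smul_eq_mul, mul_assoc, ← Finset.mul_sum, hx, mul_zero])
      (pathWeight_sub_avoid_mem_span (F := F) (C := C) ht _ (row i) rfl)
    rintro _ ⟨c, hc, rfl⟩
    obtain ⟨k, rfl⟩ := hrow c hc.1
    exact hz' k
  simp only [Pi.sub_apply, sub_mul, Finset.sum_sub_distrib, hz', zero_sub, neg_eq_zero] at this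
  exact this

/-- If `a` and `b` are connected then suitable sources make both path weight matrices
nonsingular. -/
lemma Connects.exists_sources (ht : ∀ v w, θ v w ≠ 0 → t w < t v) (h0 : ∀ v w, 0 ≤ θ v w)
    (hF : ∀ v ∈ F, ∀ w, θ v w ≠ 0 → w ∈ F) (hG : ∀ v w, G.Adj w v ↔ θ v w ≠ 0) {a b : V}
    (haC : a ∉ C) (hbC : b ∉ C) (hab : a ≠ b) (ha : a ∈ F) (hb : b ∈ F) (hC : C ⊆ F)
    (h : Connects G C a b) :
    ∃ σ : Option C → V, (∀ k, σ k ∈ F) ∧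
      (Matrix.of fun i j => pathWeight F t θ (extendBy C a i) (σ j)).det ≠ 0 ∧
      (Matrix.of fun i j => pathWeight F t θ (extendBy C b i) (σ j)).det ≠ 0 := by
  classical
  obtain ⟨n, f, ⟨hf0, hfn, hlink, hfC⟩, hchord, hinj⟩ := h.exists_chordless hab hbC
  have hn : 0 < n := Nat.pos_of_ne_zero fun hn => hab (by rw [← hf0, ← hfn, hn])
  have hex : ∀ i, ∃ u, i < n → Reaches G C u (f i) ∧ Reaches G C u (f (i + 1)) := fun i => by
    by_cases hi : i < n
    · exact (hlink i hi).imp fun _ h _ => h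
    · exact ⟨a, fun h => absurd h hi⟩
  choose s hs using hex
  -- Positions on the chain; a value of at least `n` marks an element of `C` that is not on it.
  have hpos : ∀ k : Option C, ∃ i, (i < n ∧ f i = extendBy C a k) ∨
      (n ≤ i ∧ ∀ j < n, f j ≠ extendBy C a k) := fun k => by
    by_cases hk : ∃ i < n, f i = extendBy C a k
    · exact hk.imp fun _ h => .inl h
    · push Not at hk
      exact ⟨n, .inr ⟨le_rfl, hk⟩⟩
  choose pos hpos using hpos
  have hpos1 : ∀ k, pos k < n → f (pos k) = extendBy C a k := fun k hk =>
    (hpos k).elim (fun h => h.2) fun h => absurd h.1 (not_le.2 hk)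
  have hpos2 : ∀ k, ¬ pos k < n → ∀ j < n, f j ≠ extendBy C a k := fun k hk =>
    (hpos k).elim (fun h => absurd h.1 hk) fun h => h.2
  have hout : ∀ k, ¬ pos k < n → ∃ c : C, k = some c := by
    rintro (_ | c) hk
    · exact absurd hf0 (hpos2 none hk 0 hn)
    · exact ⟨c, rfl⟩
  set σ : Option C → V := fun k => if pos k < n then s (pos k) else extendBy C a k with hσ
  have hmem : ∀ e ∈ F, ∀ k, extendBy C e k ∈ F := by
    rintro e he (_ | c)
    exacts [he, hC c.2]
  have hrow : ∀ e, ∀ c ∈ C, ∃ k, extendBy C e k = c := fun e c hc => ⟨some ⟨c, hc⟩, rfl⟩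
  have hreach : ∀ k, Reaches G C (σ k) (extendBy C a k) := by
    intro k
    simp only [hσ]
    split_ifs with hk
    · exact hpos1 k hk ▸ (hs _ hk).1
    · exact .refl
  have hiff : ∀ {u v}, v ∈ F → (pathWeight F t (avoidWeight C θ) v u ≠ 0 ↔ Reaches G C u v) :=
    fun hv => pathWeight_avoid_ne_zero_iff ht h0 hF hG hv
  refine ⟨σ, fun k => ?_, ?_, ?_⟩
  · have := (reaches_iff_avoidWeight hG).1 (hreach k)
    refine mem_of_reaches (fun v hv w h => hF v hv w fun h' => h ?_) (hmem a ha k) this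
    simp [avoidWeight, h']
  -- For `a`, a nonzero entry with `pos k < pos k'` would be a chord from `pos k` to `pos k' + 1`.
  -- An off-chain source lies in `C` and reaches only itself.
  · refine det_pathWeight_ne_zero ht _ _ (hrow a) fun β =>
      eq_zero_of_mulVec_eq_zero_of_triangular id pos
        (fun k => (hiff (hmem a ha k)).2 (hreach k)) fun k k' hkk' hle => ?_
    by_contra hne
    have hr : Reaches G C (σ k') (extendBy C a k) := (hiff (hmem a ha k)).1 hne
    by_cases hk' : pos k' < n
    · have hk : pos k < n := hle.trans_lt hk'
      have hlt : pos k < pos k' := hle.lt_of_ne fun he =>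
        hkk' (extendBy_injective haC (by rw [← hpos1 k hk, ← hpos1 k' hk', he]))
      simp only [hσ, if_pos hk', ← hpos1 k hk] at hr
      exact hchord (pos k) (pos k' + 1) (by omega) (by omega) ⟨_, hr, (hs _ hk').2⟩
    · obtain ⟨c, rfl⟩ := hout k' hk'
      simp only [hσ, if_neg hk'] at hr
      exact hkk' (extendBy_injective haC (hr.eq_of_mem c.2))
  -- For `b`, each source is paired with the far end of its link, and the order along the chain is
  -- reversed. The value `n + 1` places off-chain elements after all the others.
  · have hτ : ∀ k, ∃ k', extendBy C b k' = if pos k < n then f (pos k + 1) else extendBy C b k := by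
      intro k
      split_ifs with hk
      · rcases (Nat.succ_le_of_lt hk).lt_or_eq with h | h
        · exact hrow b _ (hfC _ (by omega) h)
        · exact ⟨none, by rw [show pos k + 1 = n from h, hfn]; rfl⟩
      · exact ⟨k, rfl⟩
    choose τ hτ using hτ
    refine det_pathWeight_ne_zero ht _ _ (hrow b) fun β =>
      eq_zero_of_mulVec_eq_zero_of_triangular τ (fun k => if pos k < n then n - pos k else n + 1)
        (fun k => (hiff (hmem b hb _)).2 ?_) fun k k' hkk' hle => ?_
    · rw [hτ]
      by_cases hk : pos k < n
      · simp only [hσ, if_pos hk]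
        exact (hs _ hk).2
      · obtain ⟨c, rfl⟩ := hout k hk
        simp only [hσ, if_neg hk]
        exact .refl
    · by_contra hne
      have hr : Reaches G C (σ k') (extendBy C b (τ k)) := (hiff (hmem b hb _)).1 hne
      rw [hτ] at hr
      by_cases hk' : pos k' < n
      · have hk : pos k < n := by
          by_contra hk
          simp only [if_neg hk, if_pos hk'] at hle
          omega
        simp only [if_pos hk, if_pos hk'] at hle
        have hne' : pos k ≠ pos k' := fun he =>
          hkk' (extendBy_injective haC (by rw [← hpos1 k hk, ← hpos1 k' hk', he]))
        simp only [hσ, if_pos hk', if_pos hk] at hr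
        exact hchord (pos k') (pos k + 1) (by omega) (by omega) ⟨_, (hs _ hk').1, hr⟩
      · obtain ⟨c, rfl⟩ := hout k' hk'
        simp only [hσ, if_neg hk'] at hr
        have he := hr.eq_of_mem c.2
        split_ifs at he with hk
        · rcases (Nat.succ_le_of_lt hk).lt_or_eq with h | h
          · exact hpos2 _ hk' _ h he.symm
          · rw [show pos k + 1 = n from h, hfn] at he
            exact hbC (he ▸ c.2)
        · obtain ⟨c', rfl⟩ := hout k hk
          exact hkk' (congrArg some (Subtype.ext he))

/-- If `a` and `b` are connected then their partial covariance given `C` does not vanish for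
suitable noise variances. -/
lemma Connects.exists_variances (ht : ∀ v w, θ v w ≠ 0 → t w < t v) (h0 : ∀ v w, 0 ≤ θ v w)
    (hF : ∀ v ∈ F, ∀ w, θ v w ≠ 0 → w ∈ F) (hG : ∀ v w, G.Adj w v ↔ θ v w ≠ 0) {a b : V}
    (haC : a ∉ C) (hbC : b ∉ C) (hab : a ≠ b) (ha : a ∈ F) (hb : b ∈ F) (hC : C ⊆ F)
    (h : Connects G C a b) :
    ∃ d : V → ℝ, (∀ u, 0 < d u) ∧
      (Matrix.of fun i j => modelCov F t θ d (extendBy C a i) (extendBy C b j)).det ≠ 0 := by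
  obtain ⟨σ, hσ, h1, h2⟩ := h.exists_sources ht h0 hF hG haC hbC hab ha hb hC
  set T1 : Matrix (Option C) (Option C) ℝ :=
    Matrix.of fun i j => pathWeight F t θ (extendBy C a i) (σ j)
  set T2 : Matrix (Option C) (Option C) ℝ :=
    Matrix.of fun i j => pathWeight F t θ (extendBy C b i) (σ j)
  set Q : Matrix (Option C) (Option C) ℝ :=
    Matrix.of fun i j => modelCov F t θ 1 (extendBy C a i) (extendBy C b j)
  -- At `δ = 0` each source carries its multiplicity in `σ` as variance and the minor is `det T1 *
  -- det T2`. Continuity then allows a positive `δ`, as variances must be positive at every vertex.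
  have hcont : Continuous fun δ : ℝ => (T1 * T2ᵀ + δ • Q).det := by fun_prop
  have hev : ∀ᶠ δ in nhds (0 : ℝ), (T1 * T2ᵀ + δ • Q).det ≠ 0 := by
    refine hcont.continuousAt.eventually_ne ?_
    rw [zero_smul, add_zero, det_mul, det_transpose]
    exact mul_ne_zero h1 h2
  obtain ⟨δ, hδ, hpos⟩ :=
    ((hev.filter_mono nhdsWithin_le_nhds).and (self_mem_nhdsWithin (s := Set.Ioi (0 : ℝ)))).exists
  refine ⟨fun u => (∑ k, if σ k = u then 1 else 0) + δ, fun u =>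
    add_pos_of_nonneg_of_pos (Finset.sum_nonneg fun k _ => by split_ifs <;> norm_num) hpos, ?_⟩
  convert hδ using 2
  ext i j
  simp only [Matrix.of_apply, Matrix.add_apply, Matrix.smul_apply, Matrix.mul_apply,
    Matrix.transpose_apply, modelCov, Pi.one_apply, one_mul, smul_eq_mul, add_mul,
    Finset.sum_add_distrib, Finset.sum_mul, Finset.mul_sum, T1, T2, Q]
  congr 1
  · rw [Finset.sum_comm]
    refine Finset.sum_congr rfl fun k _ => ?_
    rw [Finset.sum_eq_single (σ k)]
    · simp
    · intro u _ hu
      simp [hu.symm]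
    · exact fun h => absurd (hσ k) h
  · exact Finset.sum_congr rfl fun u _ => by ring

end Algebra

/-! ### From Hawkes models to path weights, and existence of Gaussian models -/

section Probability

open MeasureTheory ProbabilityTheory

variable {p q : ℕ}

lemma HawkesModel.coeff_nonneg (H : HawkesModel p q) {Δ : ℝ} (hΔ : 0 < Δ) (i j : Subprocess p q)
    {k : ℕ} (hk : 1 ≤ k) : 0 ≤ H.coeff Δ i j k := by
  have hk' : (1 : ℝ) ≤ k := by exact_mod_cast hk
  have hle : ((k : ℝ) - 1) * Δ ≤ k * Δ := by nlinarith
  rw [HawkesModel.coeff, intervalIntegral.integral_of_le hle]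
  refine setIntegral_nonneg measurableSet_Ioc fun s hs => H.excitation_nonneg i j s ?_
  exact lt_of_le_of_lt (mul_nonneg (by linarith) hΔ.le) hs.1

/-- The weight of the edge `w → v` of the window causal graph, and `0` if there is none. -/
noncomputable def HawkesModel.windowWeight (H : HawkesModel p q) (Δ : ℝ) (v w : WindowVar p q) :
    ℝ :=
  if w.2 < v.2 then H.coeff Δ v.1 w.1 ((v.2 : ℕ) - (w.2 : ℕ)) else 0

/-- The time index of a variable. -/
def windowTime (v : WindowVar p q) : ℕ := v.2

/-- The variables up to time `M`. -/
def windowUpTo (p q : ℕ) (M : ℕ+) : Finset (WindowVar p q) := Finset.univ ×ˢ Finset.Icc 1 M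

lemma mem_windowUpTo {M : ℕ+} {v : WindowVar p q} : v ∈ windowUpTo p q M ↔ v.2 ≤ M := by
  simp [windowUpTo]

variable (H : HawkesModel p q) (Δ : ℝ)

lemma HawkesModel.windowGraph_adj_iff (v w : WindowVar p q) :
    (H.windowGraph Δ).Adj w v ↔ H.windowWeight Δ v w ≠ 0 := by
  unfold HawkesModel.windowGraph HawkesModel.windowWeight
  by_cases h : w.2 < v.2 <;> simp [h]

lemma HawkesModel.windowWeight_lt (v w : WindowVar p q) (h : H.windowWeight Δ v w ≠ 0) :
    windowTime w < windowTime v := by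
  unfold HawkesModel.windowWeight at h
  split_ifs at h with hw
  · exact hw
  · exact absurd rfl h

lemma HawkesModel.windowGraph_asymm (v w : WindowVar p q) (h : (H.windowGraph Δ).Adj v w) :
    ¬ (H.windowGraph Δ).Adj w v :=
  fun h' => h.1.asymm h'.1

lemma HawkesModel.windowWeight_nonneg {Δ : ℝ} (hΔ : 0 < Δ) (v w : WindowVar p q) :
    0 ≤ H.windowWeight Δ v w := by
  unfold HawkesModel.windowWeight
  split_ifs with h
  · have : (w.2 : ℕ) < v.2 := h
    exact H.coeff_nonneg hΔ _ _ (by omega)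
  · exact le_rfl

lemma HawkesModel.windowUpTo_closed (M : ℕ+) :
    ∀ v ∈ windowUpTo p q M, ∀ w, H.windowWeight Δ v w ≠ 0 → w ∈ windowUpTo p q M := by
  intro v hv w h
  have h1 : w.2 < v.2 := H.windowWeight_lt Δ v w h
  exact mem_windowUpTo.2 (h1.le.trans (mem_windowUpTo.1 hv))

/-- Substitute `m = n - k`. The lag `k = n` points to time `0`, which is not a node of the graph;
`h0` discards it. -/
lemma sum_lag_eq_sum_pnat {M n : ℕ+} (hn : n ≤ M) (h : ℕ → ℕ → ℝ) (h0 : h n 0 = 0) :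
    ∑ k ∈ Finset.Icc 1 (n : ℕ), h k (n - k) =
      ∑ m ∈ Finset.Icc 1 M, if m < n then h ((n : ℕ) - m) m else 0 := by
  rw [← Finset.sum_filter]
  have hsub : Finset.Icc 1 ((n : ℕ) - 1) ⊆ Finset.Icc 1 (n : ℕ) :=
    Finset.Icc_subset_Icc le_rfl (Nat.sub_le _ _)
  rw [← Finset.sum_subset hsub]
  · refine Finset.sum_nbij' (fun k => ((n : ℕ) - k).toPNat') (fun m => (n : ℕ) - m) ?_ ?_ ?_ ?_ ?_
    · intro k hk
      rw [Finset.mem_Icc] at hk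
      have hk' : 0 < (n : ℕ) - k := by omega
      have hnM : (n : ℕ) ≤ M := hn
      simp only [Finset.mem_filter, Finset.mem_Icc, ← PNat.coe_le_coe, ← PNat.coe_lt_coe,
        Nat.toPNat'_coe, if_pos hk', PNat.one_coe]
      omega
    · intro m hm
      simp only [Finset.mem_filter, Finset.mem_Icc, ← PNat.coe_le_coe, ← PNat.coe_lt_coe] at hm
      have := m.pos
      rw [Finset.mem_Icc]
      omega
    · intro k hk
      rw [Finset.mem_Icc] at hk
      have hk' : 0 < (n : ℕ) - k := by omega
      simp only [Nat.toPNat'_coe, if_pos hk']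
      omega
    · intro m hm
      simp only [Finset.mem_filter, Finset.mem_Icc, ← PNat.coe_le_coe, ← PNat.coe_lt_coe] at hm
      have := m.pos
      apply PNat.eq
      rw [Nat.toPNat'_coe, if_pos (by omega)]
      omega
    · intro k hk
      rw [Finset.mem_Icc] at hk
      have hk' : 0 < (n : ℕ) - k := by omega
      simp only [Nat.toPNat'_coe, if_pos hk']
      rw [show (n : ℕ) - (n - k) = k by omega]
  · intro k hk hk'
    rw [Finset.mem_Icc] at hk hk'
    obtain rfl : k = n := by omega
    rw [Nat.sub_self, h0]

variable {H Δ} {Ω : Type*} [MeasurableSpace Ω] {P : Measure Ω} {N ε : Subprocess p q → ℕ → Ω → ℝ}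

lemma IsLinearModel.window_equation (hN : IsLinearModel H Δ P N ε) {M : ℕ+} {v : WindowVar p q}
    (hv : v ∈ windowUpTo p q M) : ∀ᵐ ω ∂P, N v.1 v.2 ω =
      ∑ w ∈ windowUpTo p q M, H.windowWeight Δ v w * N w.1 w.2 ω +
        (ε v.1 v.2 ω + Δ * H.background v.1) := by
  filter_upwards [hN.equation v.1 v.2 v.2.pos, ae_all_iff.2 hN.initial] with ω h1 h2
  rw [h1, add_assoc, windowUpTo, Finset.sum_product]
  congr 1
  refine Finset.sum_congr rfl fun j _ => ?_
  rw [sum_lag_eq_sum_pnat (mem_windowUpTo.1 hv) (fun k m => H.coeff Δ v.1 j k * N j m ω)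
    (by rw [h2 j, mul_zero])]
  refine Finset.sum_congr rfl fun m _ => ?_
  simp only [HawkesModel.windowWeight]
  split_ifs <;> simp

/-- The structural equations are substituted into each other by induction on time, the constants `Δ
μ` travelling with the noise. -/
lemma IsLinearModel.ae_eq_sum_noise (hN : IsLinearModel H Δ P N ε) {M : ℕ+} (n : ℕ) :
    ∀ v ∈ windowUpTo p q M, windowTime v = n → ∀ᵐ ω ∂P, N v.1 v.2 ω =
      ∑ u ∈ windowUpTo p q M, pathWeight (windowUpTo p q M) windowTime (H.windowWeight Δ) v u *
        (ε u.1 u.2 ω + Δ * H.background u.1) := by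
  induction n using Nat.strong_induction_on with
  | _ n ih =>
    intro v hv hn
    have hw : ∀ᵐ ω ∂P, ∀ w ∈ windowUpTo p q M, windowTime w < windowTime v → N w.1 w.2 ω =
      ∑ u ∈ windowUpTo p q M, pathWeight (windowUpTo p q M) windowTime (H.windowWeight Δ) w u *
        (ε u.1 u.2 ω + Δ * H.background u.1) := by
      rw [ae_all_iff]
      intro w
      by_cases h : w ∈ windowUpTo p q M ∧ windowTime w < windowTime v
      · filter_upwards [ih _ (hn ▸ h.2) w h.1 rfl] with ω hω _ _ using hω
      · exact .of_forall fun ω h1 h2 => absurd ⟨h1, h2⟩ h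
    filter_upwards [hN.window_equation hv, hw] with ω h1 h2
    rw [h1]
    simp_rw [pathWeight_eq (H.windowWeight_lt Δ) v, add_mul, Finset.sum_add_distrib, ite_mul,
      one_mul, zero_mul, Finset.sum_ite_eq, if_pos hv, Finset.sum_mul]
    rw [add_comm, Finset.sum_comm]
    congr 1
    refine Finset.sum_congr rfl fun w hwF => ?_
    by_cases h0 : H.windowWeight Δ v w = 0
    · simp [h0]
    · rw [h2 w hwF (H.windowWeight_lt Δ v w h0), Finset.mul_sum]
      exact Finset.sum_congr rfl fun u _ => by ring

lemma covariance_congr_ae {X X' Y Y' : Ω → ℝ} (hX : X =ᵐ[P] X') (hY : Y =ᵐ[P] Y') :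
    cov[X, Y; P] = cov[X', Y'; P] := by
  rw [covariance, covariance, integral_congr_ae hX, integral_congr_ae hY]
  refine integral_congr_ae ?_
  filter_upwards [hX, hY] with ω h1 h2
  rw [h1, h2]

lemma IsLinearModel.covariance_eq [IsProbabilityMeasure P] (hN : IsLinearModel H Δ P N ε) {M : ℕ+}
    {r s : WindowVar p q} (hr : r ∈ windowUpTo p q M) (hs : s ∈ windowUpTo p q M) :
    cov[N r.1 r.2, N s.1 s.2; P] = modelCov (windowUpTo p q M) windowTime (H.windowWeight Δ)
      (fun u => Var[ε u.1 u.2; P]) r s := by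
  set F := windowUpTo p q M
  set T := pathWeight F windowTime (H.windowWeight Δ)
  have hmem : ∀ v u : WindowVar p q, MemLp (fun ω => T v u * ε u.1 u.2 ω) 2 P := fun v u =>
    (hN.noise_memLp u.1 u.2 u.2.pos).const_mul _
  have hsum : ∀ v, MemLp (fun ω => ∑ u ∈ F, T v u * ε u.1 u.2 ω) 2 P := fun v =>
    memLp_finsetSum _ fun u _ => hmem v u
  have hae : ∀ v ∈ F, N v.1 v.2 =ᵐ[P] fun ω => (∑ u ∈ F, T v u * ε u.1 u.2 ω) +
      ∑ u ∈ F, T v u * (Δ * H.background u.1) := by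
    intro v hv
    filter_upwards [hN.ae_eq_sum_noise _ v hv rfl] with ω hω
    rw [hω, ← Finset.sum_add_distrib]
    exact Finset.sum_congr rfl fun u _ => mul_add _ _ _
  rw [covariance_congr_ae (hae r hr) (hae s hs),
    covariance_add_const_left ((hsum r).integrable one_le_two),
    covariance_add_const_right ((hsum s).integrable one_le_two),
    covariance_fun_sum_fun_sum' (fun u _ => hmem r u) fun u _ => hmem s u, modelCov]
  refine Finset.sum_congr rfl fun u hu => ?_
  rw [Finset.sum_eq_single u]
  · rw [covariance_const_mul_left, covariance_const_mul_right,
      covariance_self (hN.noise_memLp u.1 u.2 u.2.pos).aemeasurable]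
    ring
  · intro w _ hw
    rw [covariance_const_mul_left, covariance_const_mul_right, hN.noise_uncorrelated u.1 w.1 u.2 w.2
      u.2.pos w.2.pos, mul_zero, mul_zero]
    intro h
    rw [Prod.mk.injEq] at h
    exact hw (Prod.ext h.1.symm (PNat.eq h.2.symm))
  · exact fun h => absurd hu h

/-- The counts generated recursively by the noise. -/
noncomputable def solveCounts (H : HawkesModel p q) (Δ : ℝ) (e : Subprocess p q → ℕ → ℝ) :
    ℕ → Subprocess p q → ℝ
  | 0, _ => 0
  | n + 1, i => (∑ j, ∑ m : Fin (n + 1), H.coeff Δ i j (n + 1 - m) * solveCounts H Δ e m j)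
      + e i (n + 1) + Δ * H.background i
termination_by n => n
decreasing_by exact m.2

lemma solveCounts_eq (H : HawkesModel p q) (Δ : ℝ) (e : Subprocess p q → ℕ → ℝ) {n : ℕ}
    (hn : 1 ≤ n) (i : Subprocess p q) : solveCounts H Δ e n i =
      (∑ j, ∑ k ∈ Finset.Icc 1 n, H.coeff Δ i j k * solveCounts H Δ e (n - k) j)
        + e i n + Δ * H.background i := by
  obtain ⟨n, rfl⟩ := Nat.exists_eq_add_of_le' hn
  rw [solveCounts]
  congr 2
  refine Finset.sum_congr rfl fun j _ => ?_
  rw [Finset.sum_fin_eq_sum_range]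
  refine Finset.sum_nbij' (fun m => n + 1 - m) (fun k => n + 1 - k) ?_ ?_ ?_ ?_ ?_
  · intro m hm; rw [Finset.mem_range] at hm; rw [Finset.mem_Icc]; omega
  · intro k hk; rw [Finset.mem_Icc] at hk; rw [Finset.mem_range]; omega
  · intro m hm; rw [Finset.mem_range] at hm; omega
  · intro k hk; rw [Finset.mem_Icc] at hk; omega
  · intro m hm
    rw [Finset.mem_range] at hm
    rw [dif_pos hm, show n + 1 - (n + 1 - m) = m by omega]

/-- A linear model with independent Gaussian noise of prescribed variances. -/
lemma exists_isLinearModel (H : HawkesModel p q) (Δ : ℝ) {d : WindowVar p q → ℝ}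
    (hd : ∀ u, 0 < d u) :
    ∃ (P : Measure (WindowVar p q → ℝ)) (_ : IsProbabilityMeasure P)
      (N ε : Subprocess p q → ℕ → (WindowVar p q → ℝ) → ℝ),
      IsLinearModel H Δ P N ε ∧ ∀ u : WindowVar p q, Var[ε u.1 u.2; P] = d u := by
  set γ : WindowVar p q → Measure ℝ := fun u => gaussianReal 0 (d u).toNNReal
  have hmp : ∀ u, MeasurePreserving (fun ω : WindowVar p q → ℝ => ω u) (Measure.infinitePi γ)
      (γ u) := measurePreserving_eval_infinitePi γ
  have hvar : ∀ u, Var[fun ω : WindowVar p q → ℝ => ω u; Measure.infinitePi γ] = d u := fun u => by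
    have h := (hmp u).variance_fun_comp (f := id) aemeasurable_id
    simp only [id] at h
    rw [h]
    exact variance_id_gaussianReal.trans (Real.coe_toNNReal _ (hd u).le)
  have hmem : ∀ u, MemLp (fun ω : WindowVar p q → ℝ => ω u) 2 (Measure.infinitePi γ) := fun u =>
    (memLp_id_gaussianReal' 2 (by simp)).comp_measurePreserving (hmp u)
  -- `toPNat'` sends `0` to `1`, so the noise at index `0` repeats that at index `1`; this is
  -- harmless, since the model constrains noise only from index `1` on.
  refine ⟨Measure.infinitePi γ, inferInstance,
    fun i n ω => solveCounts H Δ (fun i n => ω (i, n.toPNat')) n i,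
    fun i n ω => ω (i, n.toPNat'), ⟨?_, ?_, ?_, ?_, ?_, ?_⟩, fun u => ?_⟩
  · exact fun i => .of_forall fun ω => by rw [solveCounts]
  · exact fun i n hn => .of_forall fun ω => solveCounts_eq H Δ _ hn i
  · exact fun i n _ => hmem _
  · intro i n _
    have h := integral_map (μ := Measure.infinitePi γ) (hmp (i, n.toPNat')).measurable.aemeasurable
      (f := fun x : ℝ => x) (by fun_prop)
    rw [(hmp _).map_eq] at h
    exact h.symm.trans integral_id_gaussianReal
  · exact fun i n _ => (hvar _).symm ▸ hd _
  · intro i j n m hn hm hne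
    have hne' : ((i, n.toPNat') : WindowVar p q) ≠ (j, m.toPNat') := by
      intro h
      rw [Prod.mk.injEq] at h
      refine hne (Prod.ext h.1 ?_)
      have := congrArg PNat.val h.2
      simpa [Nat.toPNat'_coe, Nat.pos_of_ne_zero, show 0 < n from hn, show 0 < m from hm] using this
    have hind := (iIndepFun_infinitePi (P := γ) (X := fun _ x => x) fun _ => measurable_id).indepFun
      hne'
    exact hind.covariance_eq_zero (hmem _) (hmem _)
  · simpa using hvar u

end Probability

/-! ### Rank bounds and the equivalences -/

section Rank

open MeasureTheory ProbabilityTheory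

variable {p q : ℕ} {H : HawkesModel p q} {Δ : ℝ} {Ω : Type*} [MeasurableSpace Ω] {P : Measure Ω}
  {N ε : Subprocess p q → ℕ → Ω → ℝ} {A B C : Finset (WindowVar p q)}

lemma exists_subset_windowUpTo (S : Finset (WindowVar p q)) : ∃ M, S ⊆ windowUpTo p q M := by
  obtain ⟨M, hM⟩ := (S.image Prod.snd).exists_le
  exact ⟨M, fun v hv => mem_windowUpTo.2 (hM _ (Finset.mem_image_of_mem _ hv))⟩

lemma card_le_rank_of_det_ne_zero {m n κ : Type*} [Fintype n] [Fintype κ] [DecidableEq κ]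
    (A : Matrix m n ℝ) (r : κ → m) (c : κ → n) (h : (A.submatrix r c).det ≠ 0) :
    Fintype.card κ ≤ A.rank := by
  rw [← Matrix.rank_of_isUnit _ ((Matrix.isUnit_iff_isUnit_det _).2 h.isUnit)]
  exact Matrix.rank_submatrix_le _ _ _

/-- The `C × C` block is a nonsingular minor, whatever the graph. -/
lemma IsLinearModel.card_le_rank [IsProbabilityMeasure P] (hN : IsLinearModel H Δ P N ε) :
    C.card ≤ (crossCov P N (A ∪ C) (B ∪ C)).rank := by
  obtain ⟨M, hM⟩ := exists_subset_windowUpTo C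
  rw [← Fintype.card_coe]
  refine card_le_rank_of_det_ne_zero _ (fun c => ⟨c, Finset.mem_union_right _ c.2⟩)
    (fun c => ⟨c, Finset.mem_union_right _ c.2⟩) ?_
  convert det_modelCov_ne_zero (H.windowWeight_lt Δ)
    (d := fun u => Var[ε u.1 u.2; P]) (fun u _ => hN.noise_variance u.1 u.2 u.2.pos) hM using 2
  ext r s
  exact hN.covariance_eq (hM r.2) (hM s.2)

lemma IsLinearModel.rank_le_card [IsProbabilityMeasure P] (hN : IsLinearModel H Δ P N ε)
    (h : ∀ a ∈ A, ∀ b ∈ B, ¬ Connects (H.windowGraph Δ) (C : Set (WindowVar p q)) a b) :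
    (crossCov P N (A ∪ C) (B ∪ C)).rank ≤ C.card := by
  obtain ⟨M, hM⟩ := exists_subset_windowUpTo (A ∪ B ∪ C)
  have hcov : ∀ r ∈ A ∪ B ∪ C, ∀ s ∈ A ∪ B ∪ C, cov[N r.1 r.2, N s.1 s.2; P] =
      modelCov (windowUpTo p q M) windowTime (H.windowWeight Δ) (fun u => Var[ε u.1 u.2; P]) r s :=
    fun r hr s hs => hN.covariance_eq (hM hr) (hM hs)
  have hα : ∀ r : ↥(A ∪ C), ∃ α : C → ℝ, ∀ s ∈ B ∪ C,
      cov[N r.1.1 r.1.2, N s.1 s.2; P] = ∑ c : C, α c * cov[N c.1.1 c.1.2, N s.1 s.2; P] := by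
    rintro ⟨r, hr⟩
    rcases Finset.mem_union.1 hr with ha | hc
    · obtain ⟨α, hα⟩ := exists_modelCov_eq_sum (F := windowUpTo p q M) (H.windowWeight_lt Δ)
        (H.windowGraph_adj_iff Δ) (d := fun u => Var[ε u.1 u.2; P])
        (fun u _ => (hN.noise_variance u.1 u.2 u.2.pos).le) (h r ha)
      refine ⟨α, fun s hs => ?_⟩
      have hs' : s ∈ A ∪ B ∪ C := by
        rw [Finset.union_assoc]
        exact Finset.mem_union_right _ hs
      rw [hcov r (by simp [ha]) s hs', hα s hs]
      exact Finset.sum_congr rfl fun c _ => by rw [hcov c (by simp) s hs']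
    · exact ⟨Pi.single ⟨r, hc⟩ 1, fun s _ => by simp [Pi.single_apply]⟩
  choose α hα using hα
  -- All rows are combinations of those of `C`, so the matrix factors through `|C|` rows.
  have hmul : crossCov P N (A ∪ C) (B ∪ C) = Matrix.of α * crossCov P N C (B ∪ C) := by
    ext r s
    simpa [crossCov, Matrix.mul_apply] using hα r s s.2
  rw [hmul]
  refine (Matrix.rank_mul_le_right _ _).trans ((Matrix.rank_le_card_height _).trans ?_)
  rw [Fintype.card_coe]

/-- The minor with rows `a, C` and columns `b, C` has size `|C| + 1` and is nonzero for suitable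
noise variances. -/
lemma exists_isLinearModel_card_lt_rank (H : HawkesModel p q) (hΔ : 0 < Δ) (hAB : Disjoint A B)
    (hAC : Disjoint A C) (hBC : Disjoint B C) {a b : WindowVar p q} (ha : a ∈ A) (hb : b ∈ B)
    (h : Connects (H.windowGraph Δ) (C : Set (WindowVar p q)) a b) :
    ∃ (P : Measure (WindowVar p q → ℝ)) (_ : IsProbabilityMeasure P)
      (N ε : Subprocess p q → ℕ → (WindowVar p q → ℝ) → ℝ),
      IsLinearModel H Δ P N ε ∧ C.card < (crossCov P N (A ∪ C) (B ∪ C)).rank := by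
  obtain ⟨M, hM⟩ := exists_subset_windowUpTo (A ∪ B ∪ C)
  obtain ⟨d, hd, hdet⟩ := h.exists_variances (F := windowUpTo p q M) (H.windowWeight_lt Δ)
    (H.windowWeight_nonneg hΔ) (H.windowUpTo_closed Δ M) (H.windowGraph_adj_iff Δ)
    (Finset.disjoint_left.1 hAC ha) (Finset.disjoint_left.1 hBC hb)
    (fun hab => Finset.disjoint_left.1 hAB ha (hab ▸ hb)) (hM (by simp [ha])) (hM (by simp [hb]))
    (Finset.subset_union_right.trans hM)
  obtain ⟨P, hP, N, ε, hN, hvar⟩ := exists_isLinearModel H Δ hd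
  refine ⟨P, hP, N, ε, hN, ?_⟩
  have hmem : ∀ {e E}, e ∈ E → ∀ k, extendBy C e k ∈ E ∪ C := by
    rintro e E he (_ | c)
    exacts [Finset.mem_union_left _ he, Finset.mem_union_right _ c.2]
  have hcard : Fintype.card (Option C) = C.card + 1 := by
    rw [Fintype.card_option, Fintype.card_coe]
  rw [← Nat.add_one_le_iff, ← hcard]
  refine card_le_rank_of_det_ne_zero _ (fun k => ⟨extendBy C a k, hmem ha k⟩)
    (fun k => ⟨extendBy C b k, hmem hb k⟩) ?_
  convert hdet using 2
  ext i j
  have hsub : ∀ {x}, x ∈ A ∪ C ∨ x ∈ B ∪ C → x ∈ windowUpTo p q M := fun hx => hM (by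
    simp only [Finset.mem_union] at hx ⊢
    tauto)
  have := hN.covariance_eq (hsub (.inl (hmem ha i))) (hsub (.inr (hmem hb j)))
  simp only [hvar] at this
  exact this

lemma IsLinearModel.rank_eq_card [IsProbabilityMeasure P] (hN : IsLinearModel H Δ P N ε)
    (hAB : Disjoint A B) (hAC : Disjoint A C) (hBC : Disjoint B C)
    (h : DSeparates (H.windowGraph Δ) (C : Set (WindowVar p q)) A B) :
    (crossCov P N (A ∪ C) (B ∪ C)).rank = C.card :=
  (hN.rank_le_card ((dSeparates_iff (H.windowGraph_asymm Δ) (Finset.disjoint_coe.2 hAB)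
    (Finset.disjoint_coe.2 hAC) (Finset.disjoint_coe.2 hBC)).1 h)).antisymm hN.card_le_rank

lemma dSeparates_of_forall_rank_le (H : HawkesModel p q) (hΔ : 0 < Δ)
    (hAB : Disjoint A B) (hAC : Disjoint A C) (hBC : Disjoint B C)
    (h : ∀ (Ω : Type) [MeasurableSpace Ω] (P : Measure Ω) [IsProbabilityMeasure P]
      (N ε : Subprocess p q → ℕ → Ω → ℝ), IsLinearModel H Δ P N ε →
      (crossCov P N (A ∪ C) (B ∪ C)).rank ≤ C.card) :
    DSeparates (H.windowGraph Δ) (C : Set (WindowVar p q)) A B := by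
  refine (dSeparates_iff (H.windowGraph_asymm Δ) (Finset.disjoint_coe.2 hAB)
    (Finset.disjoint_coe.2 hAC) (Finset.disjoint_coe.2 hBC)).2 fun a ha b hb hc => ?_
  obtain ⟨P, hP, N, ε, hN, hlt⟩ := exists_isLinearModel_card_lt_rank H hΔ hAB hAC hBC ha hb hc
  exact (h _ P N ε hN).not_gt hlt

end Rank

end POMHP

theorem mainTheorem7 {p q : ℕ} (H : POMHP.HawkesModel p q) (Δ : ℝ) (hΔ : 0 < Δ)
    (A B C : Finset (POMHP.WindowVar p q))
    (hAB : Disjoint A B) (hAC : Disjoint A C) (hBC : Disjoint B C) :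
    -- d-separation forces the rank, in every single model
    (∀ {Ω : Type*} [MeasurableSpace Ω] (P : MeasureTheory.Measure Ω)
      [MeasureTheory.IsProbabilityMeasure P] (N ε : POMHP.Subprocess p q → ℕ → Ω → ℝ),
      POMHP.IsLinearModel H Δ P N ε →
      POMHP.DSeparates (H.windowGraph Δ) (C : Set (POMHP.WindowVar p q)) A B →
      (POMHP.crossCov P N (A ∪ C) (B ∪ C)).rank = C.card) ∧
    -- the equivalence for one model, under rank faithfulness
    (∀ {Ω : Type*} [MeasurableSpace Ω] (P : MeasureTheory.Measure Ω)
      [MeasureTheory.IsProbabilityMeasure P] (N ε : POMHP.Subprocess p q → ℕ → Ω → ℝ),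
      POMHP.IsLinearModel H Δ P N ε → POMHP.RankFaithful H Δ P N →
      (POMHP.DSeparates (H.windowGraph Δ) (C : Set (POMHP.WindowVar p q)) A B ↔
        (POMHP.crossCov P N (A ∪ C) (B ∪ C)).rank = C.card)) ∧
    -- the equivalence for all models of the window graph, without faithfulness
    (POMHP.DSeparates (H.windowGraph Δ) (C : Set (POMHP.WindowVar p q)) A B ↔
      ∀ (H' : POMHP.HawkesModel p q), H'.windowGraph Δ = H.windowGraph Δ →
      ∀ (Ω : Type) [MeasurableSpace Ω] (P : MeasureTheory.Measure Ω)
        [MeasureTheory.IsProbabilityMeasure P] (N ε : POMHP.Subprocess p q → ℕ → Ω → ℝ),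
        POMHP.IsLinearModel H' Δ P N ε →
        (POMHP.crossCov P N (A ∪ C) (B ∪ C)).rank = C.card) := by
  refine ⟨fun P _ N ε hN h => hN.rank_eq_card hAB hAC hBC h, fun P _ N ε hN hfaith =>
    ⟨fun h => hN.rank_eq_card hAB hAC hBC h, fun h => ?_⟩, fun h H' hH' Ω _ P _ N ε hN => ?_,
    fun h => ?_⟩
  -- Faithfulness carries the bound `|C|` to all noise distributions for `H` itself, and these
  -- suffice to detect an open path.
  · exact POMHP.dSeparates_of_forall_rank_le H hΔ hAB hAC hBC fun Ω _ P _ N ε hN' =>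
      hfaith _ _ _ h.le H rfl Ω P N ε hN'
  · exact hN.rank_eq_card hAB hAC hBC (hH' ▸ h)
  · exact POMHP.dSeparates_of_forall_rank_le H hΔ hAB hAC hBC fun Ω _ P _ N ε hN =>
      (h H rfl Ω P N ε hN).le
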